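/- Throughout, $\lg$ is the logarithm to base $2$ and $\log$ the natural logarithm. A graph is a finite directed multigraph (self-loops allowed). For a vertex set $S$, $E(S)$ is the set of edges entering or leaving a vertex of $S$; the $S$-distance $\mathrm{dist}_H(u,v,S)$ is the least number of edges leaving vertices of $S$ on a walk from $u$ to $v$ in $H$ ($\infty$ if there is none). For a partition $P$ of the vertices of $H$, contracting $P$ gives the multigraph with node set $P$ and all edges of $H$, with end points replaced by the nodes containing them; $\mathrm{Condensation}(H)$ is obtained by contracting the strongly connected components (SCCs). $\mathrm{Flatten}$ denotes the union of a family of sets. **Separators.** For a graph $H$ with vertex set $V(H)$, $r\in V(H)$, $S\subseteq V(H)$, $d>0$, let $L_j$ be the set of vertices at $S$-distance $j$ from $r$. $\mathrm{OutSeparator}(r,H,S,d)$ takes the least $i$ such that $S_{Sep}=L_i\cap S$ and $V_{Sep}=\bigcup_{j\le i}L_j\setminus S_{Sep}$ satisfy $$|S_{Sep}|\le \frac{2\log |V(H)|}{d}\min\{|V_{Sep}\cap S|,\ |(V(H)\setminus (S_{Sep}\cup V_{Sep}))\cap S|\},$$ and returns $(S_{Sep},V_{Sep})$. $\mathrm{InSeparator}$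 is the same in the reversed graph. **Split$(H,S,d)$** returns a set of separator vertices and a partition of $V(H)$. Start with $H'=H$. While $H'$ is nonempty, pick any vertex $r$ of $H'$ and run $\mathrm{OutSeparator}(r,H',S,d/16)$ and $\mathrm{InSeparator}(r,H',S,d/16)$ in parallel; take the answer of the one that finishes first (either may) if $|V_{Sep}|\le\frac23|V(H)|$, and otherwise the answer of the other one. If the answer taken has $|V_{Sep}|\le\frac23|V(H)|$, output $S_{Sep}$ as separators and its elements as singleton parts, recurse with $\mathrm{Split}(H'[V_{Sep}],S\cap V_{Sep},d)$, and remove $S_{Sep}\cup V_{Sep}$ from $H'$. Otherwise, as long as the remaining graph $H'$ has a vertex $v$ with $\mathrm{dist}_{H'}(r,v,S)>d/2$ or $\mathrm{dist}_{H'}(v,r,S)>d/2$, pick such a $v$, compute $\mathrm{InSeparator}(v,H',S,d/4)$ in the first case and otherwise $\mathrm{OutSeparator}(v,H',S,d/4)$, output $S_{Sep}$ and recurse on $V_{Sep}$ as before, and remove $S_{Sep}\cup V_{Sep}$; then output what remains (if nonempty) as one part and stop. **The hierarchy.** Let $G$ be a graph with $n$ vertices, vertex set $V$, and let $\delta>0$.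 The algorithm keeps sets $S_0,S_1,\dots$ with $S_i=\emptyset$ for $i\ge\lfloor\lg n\rfloor+2$, partitions $\hat V_0,\dots,\hat V_{\lfloor \lg n\rfloor+1}$ of $V$, and for $i\le\lfloor\lg n\rfloor$ a center in every $X\in\hat V_{i+1}$. The level-$i$ graph $\hat G_i$ is obtained from (current graph)$\,\setminus E(S_{i+1})$ by contracting $\hat V_i$; $S_i$ is identified with the set of nodes $\{s\}$, $s\in S_i$; $\hat G_i[X]$ is the subgraph induced by the nodes contained in $X$. *Preprocessing.* $S_0=V$ and $\hat V_0$ consists of the singletons. For $i=0,\dots,\lfloor\lg n\rfloor$, run $\mathrm{Split}$ with parameter $\delta/2$ and set $S_i$ on $G$ contracted by $\hat V_i$; the separators form $S_{i+1}$, the flattened parts form $\hat V_{i+1}$, and every part gets an arbitrary center. *Deletion of an edge.* Remove the edge from the current graph. For $i=0,\dots,\lfloor\lg n\rfloor$ in this order, while some $X\in\hat V_{i+1}$ has a node $Y$ whose $S_i$-distance in $\hat G_i[X]$ from or to the node $R$ containing the center of $X$ exceeds $\delta$: pick such $X,Y$ and compute $\mathrm{InSeparator}(Y,\hat G_i[X],S_i\cap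 X,\delta/2)$ if $\mathrm{dist}(R,Y,S_i)>\delta$, otherwise $\mathrm{OutSeparator}$ with the same arguments. If $|\mathrm{Flatten}(V_{Sep})|\le\frac23|X|$, run $\mathrm{Split}(\hat G_i[V_{Sep}],S_i\cap V_{Sep},\delta/2)$, add $S_{Sep}$ and the separators found to $S_{i+1}$, and replace $X$ in $\hat V_{i+1}$ by what is left of $X$ (if nonempty, with its old center), the elements of $S_{Sep}$ as singletons, and the flattened parts found. Otherwise run $\mathrm{Split}(\hat G_i[X],S_i\cap X,\delta/2)$, add the separators found to $S_{i+1}$ and replace $X$ by the flattened parts found. New parts get arbitrary centers. **Claim.** For every run of this algorithm, with every sequence of deletions and every outcome of the arbitrary choices, at every time after preprocessing (also between two iterations in the middle of a deletion): 1. $|S_0|=n$, and for $0\le i\le\lfloor\lg n\rfloor$ $$|S_{i+1}|\le\frac{32\log n}{\delta}\sum_{X\in\hat V_{i+1}}\lg(n-|X\cap S_i|)\,|X\cap S_i|,$$ where a term with $|X\cap S_i|=n$ counts as $0$; 2. $|S_{i+1}|\le\frac{16\lg^2 n}{\delta}|S_i|$ for all $i\ge0$; 3. if $\delta=64\lg^2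 n$, then $|S_i|\le n/2^i$ for all $i\ge0$, and, whenever no deletion is in progress, the top graph $\hat G_{\lfloor\lg n\rfloor+1}$ is the condensation of the current graph. -/

import Mathlib

open scoped ENNReal

/-- A finite directed multigraph: parallel edges and self-loops are allowed, edges carry names in `ε`. -/
structure DiMultigraph (α ε : Type*) where
  verts : Finset α
  edges : Finset ε
  src : ε → α
  tgt : ε → α
  src_mem : ∀ e ∈ edges, src e ∈ verts
  tgt_mem : ∀ e ∈ edges, tgt e ∈ verts

namespace DiMultigraph

variable {α ε : Type*} [DecidableEq α] [DecidableEq ε]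

/-- The same vertices with a smaller set of edges. -/
def filterEdges (G : DiMultigraph α ε) (p : ε → Prop) [DecidablePred p] : DiMultigraph α ε where
  verts := G.verts
  edges := G.edges.filter p
  src := G.src
  tgt := G.tgt
  src_mem := fun e he => G.src_mem e (Finset.mem_filter.mp he).1
  tgt_mem := fun e he => G.tgt_mem e (Finset.mem_filter.mp he).1

/-- Deletion of one edge. -/
def deleteEdge (G : DiMultigraph α ε) (e : ε) : DiMultigraph α ε :=
  G.filterEdges (fun f => f ≠ e)

/-- `G \ E(S)`: all edges that enter or leave a vertex of `S` are removed, the vertices stay. -/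
def removeIncident (G : DiMultigraph α ε) (S : Finset α) : DiMultigraph α ε :=
  G.filterEdges (fun e => G.src e ∉ S ∧ G.tgt e ∉ S)

/-- The induced subgraph `G[X]` (on the vertices of `G` that lie in `X`). -/
def induce (G : DiMultigraph α ε) (X : Finset α) : DiMultigraph α ε where
  verts := G.verts ∩ X
  edges := G.edges.filter (fun e => G.src e ∈ X ∧ G.tgt e ∈ X)
  src := G.src
  tgt := G.tgt
  src_mem := fun e he => Finset.mem_inter.mpr
    ⟨G.src_mem e (Finset.mem_filter.mp he).1, (Finset.mem_filter.mp he).2.1⟩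
  tgt_mem := fun e he => Finset.mem_inter.mpr
    ⟨G.tgt_mem e (Finset.mem_filter.mp he).1, (Finset.mem_filter.mp he).2.2⟩

/-- The graph with all edges reversed. -/
def reverse (G : DiMultigraph α ε) : DiMultigraph α ε where
  verts := G.verts
  edges := G.edges
  src := G.tgt
  tgt := G.src
  src_mem := G.tgt_mem
  tgt_mem := G.src_mem

/-! ### Strongly connected components and condensation -/

/-- `u` reaches `v` by a directed walk. -/
def Reaches (G : DiMultigraph α ε) : α → α → Prop :=
  Relation.ReflTransGen (fun u v => ∃ e ∈ G.edges, G.src e = u ∧ G.tgt e = v)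

open Classical in
/-- The vertex sets of the strongly connected components. -/
noncomputable def sccs (G : DiMultigraph α ε) : Finset (Finset α) :=
  G.verts.image (fun v => G.verts.filter (fun u => G.Reaches u v ∧ G.Reaches v u))

/-- The member of the family `P` that contains `v` (for a partition `P`, exactly one set of `P`
contains `v`, and the union of all such sets is that set). -/
def nodeOf (P : Finset (Finset α)) (v : α) : Finset α :=
  (P.filter (fun X => v ∈ X)).sup id

/-- The multigraph with node set `P` in which the end points of every edge of `G` are replaced by the
nodes that contain them. If `P` is a partition of the vertex set, then no edge is lost
(edges inside a node become self-loops). -/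
def contract (G : DiMultigraph α ε) (P : Finset (Finset α)) : DiMultigraph (Finset α) ε where
  verts := P
  edges := G.edges.filter (fun e => nodeOf P (G.src e) ∈ P ∧ nodeOf P (G.tgt e) ∈ P)
  src := fun e => nodeOf P (G.src e)
  tgt := fun e => nodeOf P (G.tgt e)
  src_mem := fun _ he => (Finset.mem_filter.mp he).2.1
  tgt_mem := fun _ he => (Finset.mem_filter.mp he).2.2

/-- The condensation: every strongly connected component is contracted to one node. -/
noncomputable def condensation (G : DiMultigraph α ε) : DiMultigraph (Finset α) ε :=
  G.contract G.sccs

/-! ### `S`-distances -/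

/-- There is a walk from `u` to `v` in which exactly `k` edges leave a vertex of `S`. -/
inductive SWalk (G : DiMultigraph α ε) (S : Finset α) : α → α → ℕ → Prop
  | nil {u : α} (hu : u ∈ G.verts) : SWalk G S u u 0
  | snoc {u : α} {k : ℕ} {e : ε} (he : e ∈ G.edges) (h : SWalk G S u (G.src e) k) :
      SWalk G S u (G.tgt e) (k + if G.src e ∈ S then 1 else 0)

/-- The `S`-distance: the least number of edges leaving `S` on a walk from `u` to `v`
(`⊤` if there is no walk). -/
noncomputable def sdist (G : DiMultigraph α ε) (S : Finset α) (u v : α) : ℕ∞ :=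
  ⨅ (k : ℕ) (_ : SWalk G S u v k), (k : ℕ∞)

/-- `u` and `v` have `S`-distance larger than the real number `d`. -/
def Far (G : DiMultigraph α ε) (S : Finset α) (d : ℝ) (u v : α) : Prop :=
  ENNReal.ofReal d < (G.sdist S u v : ℝ≥0∞)

/-! ### Separators -/

/-- The `S`-vertices in the `i`-th layer of the breadth-first search from `r`. -/
noncomputable def layerSep (G : DiMultigraph α ε) (r : α) (S : Finset α) (i : ℕ) : Finset α :=
  G.verts.filter (fun v => G.sdist S r v = i) ∩ S

/-- All vertices in the layers `0, …, i`, except the `S`-vertices in layer `i`. -/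
noncomputable def layerSide (G : DiMultigraph α ε) (r : α) (S : Finset α) (i : ℕ) : Finset α :=
  G.verts.filter (fun v => G.sdist S r v ≤ i) \ G.layerSep r S i

/-- The `S`-vertices of layer `i` are few compared with the `S`-vertices on either side.
`G.verts.card` is the number of vertices of the graph that is searched; `Real.log` is the natural
logarithm. -/
def LayerBalanced (G : DiMultigraph α ε) (r : α) (S : Finset α) (d : ℝ) (i : ℕ) : Prop :=
  ((G.layerSep r S i).card : ℝ) ≤
    ((min (G.layerSide r S i ∩ S).card
      ((G.verts \ (G.layerSep r S i ∪ G.layerSide r S i)) ∩ S).card : ℕ) : ℝ)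
      * (2 * Real.log (G.verts.card : ℝ)) / d

/-- `OutSeparator(r, G, S, d)`: grow the layers around `r`, stop at the first layer that is balanced,
and return the pair `(S_Sep, V_Sep)`. (A balanced layer exists: every layer beyond the last nonempty
one is balanced.) -/
noncomputable def outSeparator (G : DiMultigraph α ε) (r : α) (S : Finset α) (d : ℝ) :
    Finset α × Finset α :=
  (G.layerSep r S (sInf {i | G.LayerBalanced r S d i}),
    G.layerSide r S (sInf {i | G.LayerBalanced r S d i}))

/-- `InSeparator(r, G, S, d)`: the same in the reversed graph. -/
noncomputable def inSeparator (G : DiMultigraph α ε) (r : α) (S : Finset α) (d : ℝ) :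
    Finset α × Finset α :=
  G.reverse.outSeparator r S d

/-- The separator grown from a vertex `v` that violates the distance bound `d` to the root `r`
of the tree: an in-separator if `v` is far from `r`, otherwise an out-separator. -/
def IsFarSeparator (G : DiMultigraph α ε) (S : Finset α) (r v : α) (d d' : ℝ)
    (T : Finset α × Finset α) : Prop :=
  (G.Far S d r v ∧ T = G.inSeparator v S d') ∨
    (¬ G.Far S d r v ∧ G.Far S d v r ∧ T = G.outSeparator v S d')

/-- The separator that `Split` uses at `r`, when the graph it was called on has `N` vertices. The
searches from `r` in both directions run in parallel, and either of them may finish first; its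
answer is kept if its side has at most `2N/3` vertices, otherwise the answer of the other search
is taken. -/
def IsTwoWaySeparator (G : DiMultigraph α ε) (N : ℕ) (r : α) (S : Finset α) (d : ℝ)
    (T : Finset α × Finset α) : Prop :=
  ∃ A B : Finset α × Finset α,
    ((A = G.outSeparator r S d ∧ B = G.inSeparator r S d) ∨
      (A = G.inSeparator r S d ∧ B = G.outSeparator r S d)) ∧
    T = if 3 * A.2.card ≤ 2 * N then A else B

/-- The two loops of `Split`. -/
inductive SplitMode (α : Type*)
  /-- the outer loop of a call on a graph with `N` vertices -/
  | outer (N : ℕ)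
  /-- the inner loop, which prunes the tree with root `r` -/
  | prune (r : α)

/-- `SplitRun d mode G S Sep P`: started in the loop `mode` with current graph `G`, some run of
`Split` collects from there on the separator vertices `Sep` and the parts `P`. The choice of the
vertices `r` and `v` is arbitrary. -/
inductive SplitRun (d : ℝ) :
    SplitMode α → DiMultigraph α ε → Finset α → Finset α → Finset (Finset α) → Prop
  /-- nothing is left -/
  | finish {N : ℕ} {G : DiMultigraph α ε} {S : Finset α} (hG : G.verts = ∅) :
      SplitRun d (.outer N) G S ∅ ∅
  /-- a separator with a small side was found: recurse on that side, go on with the rest -/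
  | cut {N : ℕ} {G : DiMultigraph α ε} {S : Finset α} {r : α} {T : Finset α × Finset α}
      {Sep₁ Sep₂ : Finset α} {P₁ P₂ : Finset (Finset α)}
      (hr : r ∈ G.verts) (hT : G.IsTwoWaySeparator N r S (d / 16) T)
      (hsmall : 3 * T.2.card ≤ 2 * N)
      (hrec : SplitRun d (.outer (G.induce T.2).verts.card) (G.induce T.2) (T.2 ∩ S) Sep₁ P₁)
      (hrest : SplitRun d (.outer N) (G.induce (G.verts \ (T.2 ∪ T.1))) S Sep₂ P₂) :
      SplitRun d (.outer N) G S (T.1 ∪ Sep₁ ∪ Sep₂) (P₁ ∪ T.1.image (fun s => {s}) ∪ P₂)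
  /-- both sides are large: start a tree at `r` -/
  | tree {N : ℕ} {G : DiMultigraph α ε} {S : Finset α} {r : α} {T : Finset α × Finset α}
      {Sep : Finset α} {P : Finset (Finset α)}
      (hr : r ∈ G.verts) (hT : G.IsTwoWaySeparator N r S (d / 16) T)
      (hlarge : ¬ 3 * T.2.card ≤ 2 * N)
      (hrun : SplitRun d (.prune r) G S Sep P) :
      SplitRun d (.outer N) G S Sep P
  /-- some `v` has `S`-distance more than `d / 2` from or to the root: cut it off and recurse -/
  | far {r : α} {G : DiMultigraph α ε} {S : Finset α} {v : α} {T : Finset α × Finset α}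
      {Sep₁ Sep₂ : Finset α} {P₁ P₂ : Finset (Finset α)}
      (hv : v ∈ G.verts) (hT : G.IsFarSeparator S r v (d / 2) (d / 4) T)
      (hrec : SplitRun d (.outer (G.induce T.2).verts.card) (G.induce T.2) (T.2 ∩ S) Sep₁ P₁)
      (hrest : SplitRun d (.prune r) (G.induce (G.verts \ (T.1 ∪ T.2))) S Sep₂ P₂) :
      SplitRun d (.prune r) G S (T.1 ∪ Sep₁ ∪ Sep₂) (P₁ ∪ T.1.image (fun s => {s}) ∪ P₂)
  /-- all remaining vertices are close to the root: they form one part (if there are any) -/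
  | close {r : α} {G : DiMultigraph α ε} {S : Finset α}
      (hclose : ∀ v ∈ G.verts, ¬ G.Far S (d / 2) r v ∧ ¬ G.Far S (d / 2) v r) :
      SplitRun d (.prune r) G S ∅ (({G.verts} : Finset (Finset α)).erase ∅)

/-- `(Sep, P)` is a possible result of `Split(G, S, d)`. -/
def Split (G : DiMultigraph α ε) (S : Finset α) (d : ℝ) (Sep : Finset α)
    (P : Finset (Finset α)) : Prop :=
  SplitRun d (.outer G.verts.card) G S Sep P

end DiMultigraph

/-! ### The hierarchy -/

/-- The union of a family of sets. -/
def flatten {V : Type*} [DecidableEq V] (X : Finset (Finset V)) : Finset V := X.sup id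

/-- The single-vertex nodes of the vertices in `S`. -/
def singleNodes {V : Type*} [DecidableEq V] (S : Finset V) : Finset (Finset V) :=
  S.image (fun v => {v})

/-- The data kept by the algorithm: the current graph, the separator sets `S 0, S 1, …`, the node
sets `part 0, part 1, …`, and, for every part `X ∈ part (i + 1)` (an SCC at level `i`), its
center `center i X`. -/
structure Hierarchy (V ε : Type*) where
  graph : DiMultigraph V ε
  S : ℕ → Finset V
  part : ℕ → Finset (Finset V)
  center : ℕ → Finset V → V

namespace Hierarchy

variable {V ε : Type*} [DecidableEq V] [DecidableEq ε]

/-- The graph at level `i`: its nodes are the members of `part i`, its edges are the edges of the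
current graph that are not incident to `S (i + 1)`. -/
def levelGraph (H : Hierarchy V ε) (i : ℕ) : DiMultigraph (Finset V) ε :=
  (H.graph.removeIncident (H.S (i + 1))).contract (H.part i)

/-- The induced subgraph at level `i` on the nodes that are contained in `X`. -/
def compGraph (H : Hierarchy V ε) (i : ℕ) (X : Finset V) : DiMultigraph (Finset V) ε :=
  (H.levelGraph i).induce ((H.part i).filter (fun Y => Y ⊆ X))

/-- The separator nodes at level `i` inside `X`. -/
def compSep (H : Hierarchy V ε) (i : ℕ) (X : Finset V) : Finset (Finset V) :=
  (H.compGraph i X).verts ∩ singleNodes (H.S i)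

/-- The root of the tree kept for `X` at level `i`: the node that contains the center of `X`. -/
def root (H : Hierarchy V ε) (i : ℕ) (X : Finset V) : Finset V :=
  DiMultigraph.nodeOf (H.part i) (H.center i X)

/-- `H` is a possible result of `Preprocessing(G, δ)`. -/
structure IsPreprocessed (G : DiMultigraph V ε) (δ : ℝ) (H : Hierarchy V ε) : Prop where
  graph_eq : H.graph = G
  S_zero : H.S 0 = G.verts
  part_zero : H.part 0 = singleNodes G.verts
  level : ∀ i ≤ Nat.log 2 G.verts.card, ∃ (Sep : Finset (Finset V)) (P : Finset (Finset (Finset V))),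
    (G.contract (H.part i)).Split (singleNodes (H.S i)) (δ / 2) Sep P ∧
    H.S (i + 1) = flatten Sep ∧ H.part (i + 1) = P.image flatten ∧
    ∀ X ∈ H.part (i + 1), H.center i X ∈ X
  S_top : ∀ i, Nat.log 2 G.verts.card + 2 ≤ i → H.S i = ∅

/-- One iteration of the `while` loop of `Delete` at level `i`, from `H` to `H'`. It picks a part `X`
and a node `Y` of `X` that has distance more than `δ` from or to the root, computes a separator
`T = (S_Sep, V_Sep)` from `Y`, and either cuts off and splits `V_Sep`, or splits all of `X`.
New parts get arbitrary centers. -/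
structure FixStep (δ : ℝ) (i : ℕ) (H H' : Hierarchy V ε) : Prop where
  graph_eq : H'.graph = H.graph
  S_eq : ∀ j, j ≠ i + 1 → H'.S j = H.S j
  part_eq : ∀ j, j ≠ i + 1 → H'.part j = H.part j
  center_eq : ∀ j, j ≠ i → H'.center j = H.center j
  step : ∃ X ∈ H.part (i + 1), ∃ Y ∈ (H.compGraph i X).verts,
    ∃ T : Finset (Finset V) × Finset (Finset V),
    (H.compGraph i X).IsFarSeparator (H.compSep i X) (H.root i X) Y δ (δ / 2) T ∧
    (∀ Z ∈ (H.part (i + 1)).erase X, H'.center i Z = H.center i Z) ∧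
    ∃ (Sep : Finset (Finset V)) (P : Finset (Finset (Finset V))),
    ((3 * (flatten T.2).card ≤ 2 * X.card ∧
        ((H.compGraph i X).induce T.2).Split (T.2 ∩ H.compSep i X) (δ / 2) Sep P ∧
        H'.S (i + 1) = H.S (i + 1) ∪ flatten (T.1 ∪ Sep) ∧
        H'.part (i + 1) = (H.part (i + 1)).erase X
          ∪ ({X \ flatten (T.1 ∪ T.2)} : Finset (Finset V)).erase ∅
          ∪ (P.image flatten ∪ T.1) ∧
        H'.center i (X \ flatten (T.1 ∪ T.2)) = H.center i X ∧
        ∀ Z ∈ P.image flatten ∪ T.1, H'.center i Z ∈ Z) ∨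
      (¬ 3 * (flatten T.2).card ≤ 2 * X.card ∧
        (H.compGraph i X).Split (H.compSep i X) (δ / 2) Sep P ∧
        H'.S (i + 1) = H.S (i + 1) ∪ flatten Sep ∧
        H'.part (i + 1) = (H.part (i + 1)).erase X ∪ P.image flatten ∧
        ∀ Z ∈ P.image flatten, H'.center i Z ∈ Z))

/-- At level `i`, no tree has a node at distance more than `δ` from or to its root. -/
def LevelFixed (δ : ℝ) (i : ℕ) (H : Hierarchy V ε) : Prop :=
  ∀ X ∈ H.part (i + 1), ∀ Y ∈ (H.compGraph i X).verts,
    ¬ (H.compGraph i X).Far (H.compSep i X) δ (H.root i X) Y ∧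
    ¬ (H.compGraph i X).Far (H.compSep i X) δ Y (H.root i X)

/-- `Course G δ k H`: the state `H` can occur when the algorithm is run on the initial graph `G` with
parameter `δ` and an arbitrary sequence of edge deletions. The counter `k` says that the levels
below `k` have been brought up to date after the last deletion; so `k = ⌊lg n⌋ + 1` means that no
deletion is in progress, and smaller `k` are the states in the middle of a deletion, while level
`k` is treated. -/
inductive Course (G : DiMultigraph V ε) (δ : ℝ) : ℕ → Hierarchy V ε → Prop
  | start {H : Hierarchy V ε} (h : IsPreprocessed G δ H) :
      Course G δ (Nat.log 2 G.verts.card + 1) H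
  | delete {H : Hierarchy V ε} {e : ε} (h : Course G δ (Nat.log 2 G.verts.card + 1) H)
      (he : e ∈ H.graph.edges) :
      Course G δ 0 { H with graph := H.graph.deleteEdge e }
  | fix {k : ℕ} {H H' : Hierarchy V ε} (h : Course G δ k H)
      (hk : k ≤ Nat.log 2 G.verts.card) (hstep : FixStep δ k H H') :
      Course G δ k H'
  | next {k : ℕ} {H : Hierarchy V ε} (h : Course G δ k H)
      (hk : k ≤ Nat.log 2 G.verts.card) (hfixed : LevelFixed δ k H) :
      Course G δ (k + 1) H

end Hierarchy

set_option linter.unusedSectionVars false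

/-! Both size bounds come from one amortisation argument. Call `φ x N` a potential with rate `c` if,
whenever a part with `N` vertices, `x` of them in `S_i`, is cut by a balanced separator, the total
of `φ` drops by at least `c` per separator vertex (`IsPotential`). Then the sum of `φ` over the
parts of level `i + 1`, plus `c * |S_{i+1}|`, never exceeds `φ |S_i| n`. Every cut made in
preprocessing or during a deletion is balanced with parameter at least `δ / 32`, so all of them are
handled by `IsCut.decomposes`. When `S_i` itself grows, the inequality survives because a new vertex
raises `φ |S_i| n` by at least as much as the term of the part containing it (the field `grow`).

Two potentials are used. The first, `x lg x` with rate `δ / (32 log n) + 2`, gives claim 1. The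
deficit `|S_i| lg |S_i| - ∑ x lg x` is compared with `∑ x lg (n - x)` through `x (n - x) ≥ n - 1`;
the error is at most 2 and is absorbed by the summand 2 of the rate. The second, `(16 / δ) x lg² N`
with rate 1, gives claim 2 at once, since it is nonnegative; its cut condition rests on
`log_sq_cut`. For `δ = 64 lg² n` the factor in claim 2 is 1/4, so the sets `S_i` shrink at least by
half per level and `S_{⌊lg n⌋+1}` is empty.

The condensation needs two facts. The side of a cut can be left (or entered) only through separator
vertices, so once the edges at separators are removed no strongly connected class is torn apart:
mutually reachable vertices share a part. Conversely, on a level that is up to date every node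
reaches the root of its part and is reached from it, so by induction over the levels all parts are
strongly connected. With no separators left at the top, the parts there are exactly the SCCs. -/

/-! ### Logarithm inequalities behind the two potentials -/

theorem log_two_le_mul_log_one_add_div {a b : ℝ} (ha : 0 < a) (hab : a ≤ b) :
    a * Real.log 2 ≤ b * Real.log (1 + a / b) := by
  have hb : 0 < b := ha.trans_le hab
  have h1 : (1 : ℝ) ≤ b / a := (one_le_div ha).2 hab
  have h0 : 0 < a / b := div_pos ha hb
  -- Bernoulli with exponent `b / a ≥ 1`: `2 ≤ (1 + a / b) ^ (b / a)`.
  have h := one_add_mul_self_le_rpow_one_add (s := a / b) (by linarith) h1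
  have e : b / a * (a / b) = 1 := by field_simp
  rw [e] at h
  have h2 := Real.log_le_log (by norm_num) h
  rw [Real.log_rpow (by linarith)] at h2
  norm_num at h2
  calc a * Real.log 2 ≤ a * (b / a * Real.log (1 + a / b)) := by gcongr
    _ = b * Real.log (1 + a / b) := by field_simp

/-- Split the right side as `a log (a + b) + b log (a + b)`. The first summand gains `a log 2`
because `a + b ≥ 2a`, the second gains `a log 2` by the Bernoulli estimate. -/
theorem mul_log_add_ge {a b : ℝ} (ha : 0 < a) (hab : a ≤ b) :
    a * Real.log a + b * Real.log b + 2 * a * Real.log 2 ≤ (a + b) * Real.log (a + b) := by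
  have hb : 0 < b := ha.trans_le hab
  have h := log_two_le_mul_log_one_add_div ha hab
  have e : 1 + a / b = (a + b) / b := by field_simp; ring
  rw [e, Real.log_div (by positivity) hb.ne'] at h
  have h2 : Real.log (2 * a) ≤ Real.log (a + b) := Real.log_le_log (by positivity) (by linarith)
  rw [Real.log_mul (by norm_num) ha.ne'] at h2
  nlinarith

theorem mul_log_add_nat_ge {y : ℝ} (hy : 1 ≤ y) (s : ℕ) :
    y * Real.log y + 2 * s * Real.log 2 ≤ (y + s) * Real.log (y + s) := by
  induction s with
  | zero => simp
  | succ s ih =>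
    have h1 : (1 : ℝ) ≤ y + s := by have : (0 : ℝ) ≤ s := Nat.cast_nonneg s; linarith
    have h := mul_log_add_ge one_pos h1
    have h2 : 1 + (y + s) = y + ((s + 1 : ℕ) : ℝ) := by push_cast; ring
    rw [h2] at h
    simp only [Real.log_one] at h
    push_cast at h ih ⊢
    linarith

/-- Merging `a` and `b` gains `2 min a b`; the `s` separator vertices are then added one at a time,
each as a part of size 1, and gain 2 each. -/
theorem mul_logb_cut {a b s : ℕ} (ha : 1 ≤ a) (hb : 1 ≤ b) :
    (a : ℝ) * Real.logb 2 a + b * Real.logb 2 b + 2 * (min a b : ℕ) + 2 * s ≤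
      ((a + b + s : ℕ) : ℝ) * Real.logb 2 ((a + b + s : ℕ) : ℝ) := by
  wlog hab : a ≤ b generalizing a b
  · have := this hb ha (le_of_not_ge hab)
    rw [min_comm, add_comm b a] at this
    linarith
  rw [min_eq_left hab]
  have ha' : (1 : ℝ) ≤ a := by exact_mod_cast ha
  have hab' : (a : ℝ) ≤ b := by exact_mod_cast hab
  have h1 := mul_log_add_ge (by linarith : (0 : ℝ) < a) hab'
  have h2 := mul_log_add_nat_ge (y := (a : ℝ) + b) (by linarith) s
  have hl : 0 < Real.log 2 := Real.log_pos (by norm_num)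
  simp only [Real.logb]
  push_cast
  rw [← sub_nonneg]
  have : ((a : ℝ) + b + s) * (Real.log (a + b + s) / Real.log 2) -
      (a * (Real.log a / Real.log 2) + b * (Real.log b / Real.log 2) + 2 * a + 2 * s) =
      (((a : ℝ) + b + s) * Real.log (a + b + s) -
      (a * Real.log a + b * Real.log b + 2 * a * Real.log 2 + 2 * s * Real.log 2)) / Real.log 2 := by
    field_simp
  rw [this]
  apply div_nonneg _ hl.le
  linarith

/-- The analytic core of `log_sq_cut`, with `A = log N`, `α = log (N / p)`, `β = log (N / q)`; the
right side is `2A² - (A - α)² - (A - β)²`. If `α + β` exceeds 1.9219, a decimal upper bound for `4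
log² 2`, then `α, β ≤ A` suffices. Otherwise `α β ≥ 0.28` keeps `α² + β² = (α + β)² - 2αβ` small
enough. The bound on `A` is just below `log 6`. -/
theorem log_sq_cut_of_large {A α β : ℝ} (hA : 1.79 ≤ A) (hα : α ≤ A) (hβ : 0 ≤ β)
    (hβα : β ≤ α) (hsum : 2 * Real.log 2 ≤ α + β) (hexp : Real.exp (-α) ≤ β) :
    4 * Real.log 2 ^ 2 * A ≤ 2 * A * (α + β) - α ^ 2 - β ^ 2 := by
  have hl := Real.log_two_gt_d9
  have hu := Real.log_two_lt_d9
  have hk : 4 * Real.log 2 ^ 2 ≤ 1.9219 := by nlinarith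
  have hkA : 4 * Real.log 2 ^ 2 * A ≤ 1.9219 * A := by gcongr
  refine hkA.trans ?_
  rcases le_or_gt 1.9219 (α + β) with h | h
  · nlinarith
  have hα1 : 0.693 ≤ α := by linarith
  have hα2 : α ≤ 1.9219 := by linarith
  -- `α e^{-α}` is the concave function `-x log x` at `x = e^{-α}`, so on `0.693 ≤ α ≤ 1.9219` it is
  -- at least the smaller of its two end values.
  have hexp' : 0.28 ≤ α * Real.exp (-α) := by
    have hm : Real.exp (-α) ∈ Set.Icc (Real.exp (-1.9219)) (Real.exp (-0.693)) :=
      ⟨Real.exp_le_exp.2 (by linarith), Real.exp_le_exp.2 (by linarith)⟩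
    have := (Real.concaveOn_negMulLog).min_le_of_mem_Icc
      (x := Real.exp (-1.9219)) (y := Real.exp (-0.693)) (Real.exp_pos _).le (Real.exp_pos _).le hm
    simp only [Real.negMulLog, Real.log_exp] at this
    have e1 : (0.1457 : ℝ) ≤ Real.exp (-1.9219) := by
      -- Estimates `e^{1.9219}` as `e² / e^{0.0781}`.
      have h3 : Real.exp 1.9219 * Real.exp 0.0781 = Real.exp 1 ^ 2 := by
        rw [← Real.exp_add, ← Real.exp_nat_mul]; norm_num
      have h4 := Real.quadratic_le_exp_of_nonneg (x := 0.0781) (by norm_num)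
      have h5 := Real.exp_one_lt_d9
      have h6 := Real.exp_pos 1.9219
      have h7 : Real.exp 1 ^ 2 ≤ 2.7182818286 ^ 2 := by gcongr
      have h8 : Real.exp 1.9219 ≤ 6.86 := by nlinarith
      rw [Real.exp_neg]
      rw [le_inv_comm₀ (by norm_num) h6]
      linarith
    have e2 : (1 / 2 : ℝ) ≤ Real.exp (-0.693) := by
      have : (1 / 2 : ℝ) = Real.exp (-Real.log 2) := by
        rw [Real.exp_neg, Real.exp_log (by norm_num)]; norm_num
      rw [this]
      exact Real.exp_le_exp.2 (by linarith)
    have e3 : (0.28 : ℝ) ≤ min (-Real.exp (-1.9219) * -1.9219) (-Real.exp (-0.693) * -0.693) :=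
      le_min (by nlinarith) (by nlinarith)
    linarith
  have hab : 0.28 ≤ α * β := by nlinarith
  have h1 : 1.3862 ≤ α + β := by linarith
  nlinarith [mul_nonneg (sub_nonneg.2 h1) (sub_nonneg.2 h.le)]

/-- After division by `log² 2` this says that the two values of `lg²` drop by at least `4 log N` in
total when `N` is cut into `p` and `q`. The extra 1 in `hN` stands for a nonempty separator and
cannot be omitted: `p = q = 1`, `N = 2` fails. -/
theorem log_sq_cut {p q N : ℕ} (hp : 1 ≤ p) (hq : 1 ≤ q) (hN : p + q + 1 ≤ N) :
    Real.log p ^ 2 + Real.log q ^ 2 + 4 * Real.log 2 ^ 2 * Real.log N ≤ 2 * Real.log N ^ 2 := by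
  wlog hpq : p ≤ q generalizing p q
  · have := this hq hp (by omega) (le_of_not_ge hpq)
    linarith
  have hl := Real.log_two_gt_d9
  have hu := Real.log_two_lt_d9
  have hp' : (1 : ℝ) ≤ p := by exact_mod_cast hp
  have hq' : (1 : ℝ) ≤ q := by exact_mod_cast hq
  have hpq' : (p : ℝ) ≤ q := by exact_mod_cast hpq
  have hN' : (p : ℝ) + q + 1 ≤ N := by exact_mod_cast hN
  have hp0 : 0 ≤ Real.log p := Real.log_nonneg hp'
  have hq0 : 0 ≤ Real.log q := Real.log_nonneg hq'
  have hk : 4 * Real.log 2 ^ 2 ≤ 1.9219 := by nlinarith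
  have h4 : Real.log 4 = 2 * Real.log 2 := by
    rw [show (4 : ℝ) = 2 ^ 2 by norm_num, Real.log_pow]; norm_num
  -- For `N ≥ 6` the analytic estimate applies; below, only four pairs `p ≤ q` remain and are
  -- checked numerically.
  rcases le_or_gt 6 N with h6 | h6
  · have h6' : (6 : ℝ) ≤ N := by exact_mod_cast h6
    have hA : 1.79 ≤ Real.log N := by
      have h := Real.log_le_log (by norm_num) h6'
      rw [show (6 : ℝ) = 2 * 3 by norm_num, Real.log_mul (by norm_num) (by norm_num)] at h
      have := Real.log_three_gt_d9
      linarith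
    have hNpos : (0 : ℝ) < N := by linarith
    have hqN : Real.log q ≤ Real.log N := Real.log_le_log (by linarith) (by linarith)
    have h := log_sq_cut_of_large (A := Real.log N) (α := Real.log N - Real.log p)
      (β := Real.log N - Real.log q) hA (by linarith) (by linarith)
      (by have := Real.log_le_log (by linarith) hpq'; linarith)
      (by
        -- `4pq ≤ (p + q)² ≤ N²` gives `α + β ≥ 2 log 2`.
        have h := Real.log_le_log (x := 4 * (p * q)) (y := (N : ℝ) ^ 2) (by positivity)
          (by nlinarith [sq_nonneg ((p : ℝ) - q)])
        rw [Real.log_mul (by norm_num) (by positivity), Real.log_mul (by positivity)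
          (by positivity), Real.log_pow, h4] at h
        push_cast at h
        linarith)
      (by
        have e : Real.exp (-(Real.log N - Real.log p)) = p / N := by
          rw [neg_sub, Real.exp_sub, Real.exp_log hNpos, Real.exp_log (by linarith)]
        rw [e]
        -- `e^{-α} = p / N ≤ 1 - q / N ≤ log (N / q) = β`.
        have h := Real.one_sub_inv_le_log_of_pos (x := (N : ℝ) / q) (by positivity)
        rw [Real.log_div hNpos.ne' (by positivity), inv_div] at h
        refine le_trans ?_ h
        rw [one_sub_div hNpos.ne']
        gcongr
        linarith)
    nlinarith
  · have l3 := Real.log_three_gt_d9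
    have l3' := Real.log_three_lt_d9
    have : (p = 1 ∧ q = 1 ∨ p = 1 ∧ q = 2 ∨ p = 1 ∧ q = 3 ∨ p = 2 ∧ q = 2) ∧ 3 ≤ N ∧
        (q = 2 → 4 ≤ N) ∧ (p = 2 ∨ q = 3 → 5 ≤ N) := by omega
    obtain ⟨hc, -⟩ := this
    have h3N : Real.log 3 ≤ Real.log N :=
      Real.log_le_log (by norm_num) (by linarith)
    rcases hc with ⟨rfl, rfl⟩ | ⟨rfl, rfl⟩ | ⟨rfl, rfl⟩ | ⟨rfl, rfl⟩
    · norm_num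
      nlinarith
    · have : Real.log 4 ≤ Real.log N := Real.log_le_log (by norm_num) (by push_cast at hN'; linarith)
      norm_num
      nlinarith
    · have h25 : Real.log (2 ^ 3 * 3) ≤ Real.log (N ^ 2) :=
        Real.log_le_log (by norm_num) (by push_cast at hN'; nlinarith)
      rw [Real.log_mul (by norm_num) (by norm_num), Real.log_pow, Real.log_pow] at h25
      push_cast at h25
      norm_num
      nlinarith
    · have : Real.log 4 ≤ Real.log N := Real.log_le_log (by norm_num) (by push_cast at hN'; linarith)
      norm_num
      nlinarith

/-! ### The two potentials -/

/-- A function `φ` of the number of separator vertices in a part and of the size of the part that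
pays `c` for every separator vertex whenever a part of at most `n` vertices is cut by a balanced
separator with parameter `d`. -/
structure IsPotential (n : ℕ) (d : ℝ) (φ : ℕ → ℕ → ℝ) (c : ℝ) : Prop where
  cost_nonneg : 0 ≤ c
  nonneg : ∀ x N, 0 ≤ φ x N
  cut : ∀ s a b Na Nb : ℕ, a ≤ Na → b ≤ Nb → Na + Nb + s ≤ n →
    (s : ℝ) ≤ (min a b : ℕ) * (2 * Real.log ((Na + Nb + s : ℕ) : ℝ)) / d →
    φ a Na + φ b Nb + s * φ 1 1 + c * s ≤ φ (a + b + s) (Na + Nb + s)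
  grow : ∀ x m N : ℕ, x ≤ m → N ≤ n → φ (x + 1) N + φ m n ≤ φ x N + φ (m + 1) n

/-- The balance condition gives `(d / log n) * s ≤ 2 min a b`, and `mul_logb_cut` pays `2 min a b +
2s`; this is the rate. The growth condition is convexity of `x log x`. -/
theorem isPotential_mul_logb {n : ℕ} {d : ℝ} (hd : 0 < d) :
    IsPotential n d (fun x _ => x * Real.logb 2 x) (d / Real.log n + 2) where
  cost_nonneg := by
    have := Real.log_natCast_nonneg n
    positivity
  nonneg x _ := by
    rcases Nat.eq_zero_or_pos x with rfl | hx
    · simp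
    · exact mul_nonneg (Nat.cast_nonneg _) (Real.logb_nonneg (by norm_num) (by exact_mod_cast hx))
  cut s a b Na Nb ha hb hn hs := by
    rcases Nat.eq_zero_or_pos s with rfl | hs0
    · have mono : ∀ x y : ℕ, (x : ℝ) * Real.logb 2 x ≤ x * Real.logb 2 ((x + y : ℕ) : ℝ) := by
        intro x y
        rcases Nat.eq_zero_or_pos x with rfl | hx
        · simp
        · have hx' : (0 : ℝ) < x := by exact_mod_cast hx
          gcongr
          · norm_num
          · omega
      have h1 := mono a b
      have h2 := mono b a
      rw [add_comm b a] at h2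
      push_cast at h1 h2 ⊢
      simp only [add_zero, zero_mul, mul_zero]
      linarith
    -- A nonempty balanced separator has `S`-vertices on both sides.
    · have hm : 1 ≤ min a b := by
        by_contra h
        have : min a b = 0 := by omega
        rw [this] at hs
        simp only [Nat.cast_zero, zero_mul, zero_div] at hs
        have : (0 : ℝ) < s := by exact_mod_cast hs0
        linarith
      have hc := mul_logb_cut (a := a) (b := b) (s := s) (by omega) (by omega)
      have hlog : 0 < Real.log n := Real.log_pos (by exact_mod_cast (by omega : 1 < n))
      have hle : Real.log ((Na + Nb + s : ℕ) : ℝ) ≤ Real.log n :=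
        Real.log_le_log (by exact_mod_cast (by omega : 0 < Na + Nb + s)) (by exact_mod_cast hn)
      have hK : d / Real.log n * s ≤ 2 * (min a b : ℕ) := by
        rw [div_mul_eq_mul_div, div_le_iff₀ hlog]
        rw [le_div_iff₀ hd] at hs
        have : ((min a b : ℕ) : ℝ) * (2 * Real.log ((Na + Nb + s : ℕ) : ℝ)) ≤
          (min a b : ℕ) * (2 * Real.log n) := by gcongr
        linarith
      simp only [Nat.cast_one, Real.logb_one, mul_zero]
      linarith
  grow x m N hx _ := by
    induction m, hx using Nat.le_induction with
    | base => exact le_of_eq (add_comm _ _)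
    | succ m hm ih =>
      have h := Real.convexOn_mul_log.2 (show (m : ℝ) ∈ Set.Ici 0 from Nat.cast_nonneg (α := ℝ) m)
        (Set.mem_Ici.2 (Nat.cast_nonneg (α := ℝ) (m + 1 + 1)))
        (show (0 : ℝ) ≤ 1 / 2 by norm_num) (show (0 : ℝ) ≤ 1 / 2 by norm_num) (by norm_num)
      have e : (1 / 2 : ℝ) • (m : ℝ) + (1 / 2 : ℝ) • ((m + 1 + 1 : ℕ) : ℝ) = ((m + 1 : ℕ) : ℝ) := by
        push_cast; simp only [smul_eq_mul]; ring
      rw [e] at h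
      simp only [smul_eq_mul] at h
      have hl : 0 < Real.log 2 := Real.log_pos (by norm_num)
      have h' : 2 * (((m + 1 : ℕ) : ℝ) * Real.logb 2 ((m + 1 : ℕ) : ℝ)) ≤
          m * Real.logb 2 m + ((m + 1 + 1 : ℕ) : ℝ) * Real.logb 2 ((m + 1 + 1 : ℕ) : ℝ) := by
        simp only [Real.logb, ← mul_div_assoc]
        rw [← add_div]
        gcongr
        linarith
      linarith

/-- Each `S`-vertex on a side gains the drop of `lg²` of its part size. Both sides have at least
`min a b` of them, so the total gain is at least `min a b` times the two drops together, hence `4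
log N * min a b` by `log_sq_cut`. With parameter `δ / 32` the balance condition reads `s ≤ (16 / δ)
* min a b * 4 log N`. -/
theorem isPotential_mul_logb_sq {n : ℕ} {δ : ℝ} (hδ : 0 < δ) :
    IsPotential n (δ / 32) (fun x N => 16 / δ * (x * Real.logb 2 N ^ 2)) 1 where
  cost_nonneg := zero_le_one
  nonneg x N := by positivity
  cut s a b Na Nb ha hb hn hs := by
    have mono : ∀ x M N : ℕ, x ≤ M → M ≤ N →
        (x : ℝ) * Real.logb 2 M ^ 2 ≤ x * Real.logb 2 N ^ 2 := by
      intro x M N h1 h2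
      rcases Nat.eq_zero_or_pos x with rfl | hx
      · simp
      · have hM : (1 : ℝ) ≤ M := by exact_mod_cast (by omega : 1 ≤ M)
        have := Real.logb_nonneg (b := 2) (by norm_num) hM
        gcongr
        norm_num
    set N := Na + Nb + s with hN
    rcases Nat.eq_zero_or_pos s with rfl | hs0
    · have h1 := mono a Na N ha (by omega)
      have h2 := mono b Nb N hb (by omega)
      have : 0 < 16 / δ := by positivity
      push_cast
      simp only [add_zero, zero_mul, mul_zero]
      rw [← mul_add]
      gcongr
      linarith
    · have hm : 1 ≤ min a b := by
        by_contra h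
        have : min a b = 0 := by omega
        rw [this] at hs
        simp only [Nat.cast_zero, zero_mul, zero_div] at hs
        have : (0 : ℝ) < s := by exact_mod_cast hs0
        linarith
      have h1 := mono a Na N ha (by omega)
      have h2 := mono b Nb N hb (by omega)
      have hc := log_sq_cut (p := Na) (q := Nb) (N := N) (by omega) (by omega) (by omega)
      have hl : 0 < Real.log 2 := Real.log_pos (by norm_num)
      have hc' : 4 * Real.log N ≤ (Real.logb 2 N ^ 2 - Real.logb 2 Na ^ 2) +
          (Real.logb 2 N ^ 2 - Real.logb 2 Nb ^ 2) := by
        simp only [Real.logb]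
        rw [← sub_nonneg]
        have : (Real.log N / Real.log 2) ^ 2 - (Real.log Na / Real.log 2) ^ 2 +
          ((Real.log N / Real.log 2) ^ 2 - (Real.log Nb / Real.log 2) ^ 2) - 4 * Real.log N =
          (2 * Real.log N ^ 2 - (Real.log Na ^ 2 + Real.log Nb ^ 2 +
            4 * Real.log 2 ^ 2 * Real.log N)) / Real.log 2 ^ 2 := by
          field_simp; ring
        rw [this]
        apply div_nonneg _ (by positivity)
        linarith
      have g1 := mono 1 Na N (by omega) (by omega)
      have g2 := mono 1 Nb N (by omega) (by omega)
      simp only [Nat.cast_one, one_mul] at g1 g2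
      have k1 : ((min a b : ℕ) : ℝ) * (Real.logb 2 N ^ 2 - Real.logb 2 Na ^ 2) ≤
          a * (Real.logb 2 N ^ 2 - Real.logb 2 Na ^ 2) :=
        mul_le_mul_of_nonneg_right (by exact_mod_cast min_le_left _ _) (by linarith)
      have k2 : ((min a b : ℕ) : ℝ) * (Real.logb 2 N ^ 2 - Real.logb 2 Nb ^ 2) ≤
          b * (Real.logb 2 N ^ 2 - Real.logb 2 Nb ^ 2) :=
        mul_le_mul_of_nonneg_right (by exact_mod_cast min_le_right _ _) (by linarith)
      have k3 := mul_le_mul_of_nonneg_left hc' (Nat.cast_nonneg (min a b) (α := ℝ))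
      have hs' : (s : ℝ) ≤ 16 / δ * ((min a b : ℕ) * (4 * Real.log N)) := by
        refine hs.trans (le_of_eq ?_)
        field_simp; ring
      have k4 : 0 ≤ (s : ℝ) * Real.logb 2 N ^ 2 := by positivity
      have k5 : (s : ℝ) ≤ 16 / δ * (((a + b + s : ℕ) : ℝ) * Real.logb 2 N ^ 2 -
          a * Real.logb 2 Na ^ 2 - b * Real.logb 2 Nb ^ 2) := by
        refine hs'.trans ?_
        gcongr
        have : ((a + b + s : ℕ) : ℝ) = a + b + s := by push_cast; ring
        rw [this]
        linarith
      simp only [Nat.cast_one, Real.logb_one]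
      linarith
  grow x m N hx hN := by
    have : (Real.logb 2 N) ^ 2 ≤ Real.logb 2 n ^ 2 := by
      rcases Nat.eq_zero_or_pos N with rfl | hN0
      · simp; positivity
      · have hM : (1 : ℝ) ≤ N := by exact_mod_cast (by omega : 1 ≤ N)
        have := Real.logb_nonneg (b := 2) (by norm_num) hM
        gcongr
        norm_num
    have h16 : 0 < 16 / δ := by positivity
    have := mul_le_mul_of_nonneg_left this h16.le
    push_cast
    linarith

/-! ### Comparing `x lg x` with `x lg (n - x)` -/

/-- For `1 ≤ x ≤ n - 1` this is `x (n - x) ≥ n - 1`. For `x = n` the right side is 0, because `logb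
2 0 = 0`, and the left side is nonpositive. -/
theorem mul_logb_div_le {n x : ℕ} (hx : x ≤ n) :
    (x : ℝ) * (Real.logb 2 ((n : ℝ) - 1) - Real.logb 2 x) ≤ Real.logb 2 ((n : ℝ) - x) * x := by
  rcases Nat.eq_zero_or_pos x with rfl | hx0
  · simp
  have hx1 : (1 : ℝ) ≤ x := by exact_mod_cast hx0
  rcases hx.eq_or_lt with rfl | hlt
  · simp only [sub_self, Real.logb_zero, zero_mul]
    rcases Nat.lt_or_ge x 2 with h | h
    · have : x = 1 := by omega
      subst this
      simp
    · have h2 : (2 : ℝ) ≤ x := by exact_mod_cast h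
      have : Real.logb 2 ((x : ℝ) - 1) ≤ Real.logb 2 x :=
        Real.logb_le_logb_of_le (by norm_num) (by linarith) (by linarith)
      exact mul_nonpos_of_nonneg_of_nonpos (by linarith) (by linarith)
  · have hlt' : (x : ℝ) + 1 ≤ n := by exact_mod_cast hlt
    rw [mul_comm]
    refine mul_le_mul_of_nonneg_right ?_ (by linarith)
    rw [sub_le_iff_le_add, ← Real.logb_mul (by linarith) (by linarith)]
    apply Real.logb_le_logb_of_le (by norm_num) (by linarith)
    nlinarith

/-- The error made in replacing `lg n` by `lg (n - 1)`. Equality holds at `n = 2`. From `n = 4` on,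
`log t ≤ t - 1` suffices, as `4 / 3 < 2 log 2`; for `n = 3` it is too weak and the value of `log 3`
is needed. -/
theorem mul_logb_sub_le {n : ℕ} (hn : 2 ≤ n) :
    (n : ℝ) * (Real.logb 2 n - Real.logb 2 ((n : ℝ) - 1)) ≤ 2 := by
  have hn' : (2 : ℝ) ≤ n := by exact_mod_cast hn
  have hl := Real.log_two_gt_d9
  rw [← Real.logb_div (by linarith) (by linarith), Real.logb, ← mul_div_assoc,
    div_le_iff₀ (by linarith)]
  rcases hn.eq_or_lt with rfl | h3
  · norm_num
  have h3' : (3 : ℝ) ≤ n := by exact_mod_cast h3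
  have h1 : Real.log ((n : ℝ) / (n - 1)) ≤ 1 / (n - 1) := by
    have := Real.log_le_sub_one_of_pos (x := (n : ℝ) / (n - 1))
      (div_pos (by linarith) (by linarith))
    refine this.trans (le_of_eq ?_)
    have : (n : ℝ) - 1 ≠ 0 := by linarith
    field_simp
    ring
  rcases (Nat.succ_le_of_lt h3).eq_or_lt with h | h4
  · subst h
    have := Real.log_three_lt_d9
    have e : ((Nat.succ 2 : ℕ) : ℝ) = 3 := by norm_num
    rw [e, Real.log_div (by norm_num) (by norm_num), show (3 : ℝ) - 1 = 2 by norm_num]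
    linarith
  · have h4' : (4 : ℝ) ≤ n := by exact_mod_cast h4
    calc (n : ℝ) * Real.log (n / (n - 1)) ≤ n * (1 / (n - 1)) := by gcongr
      _ ≤ 4 / 3 := by
        rw [mul_one_div, div_le_div_iff₀ (by linarith) (by norm_num)]
        linarith
      _ ≤ _ := by linarith

/-! ### Mutual reachability and balanced cuts of one graph -/

/-- If `v` reaches back to `u`, every vertex on a walk from `u` to `v` is mutually reachable with
`u`. So only edges inside one strongly connected class have to be preserved. -/
theorem reflTransGen_map_of_mutual {α β : Type*} {r : α → α → Prop} {r' : β → β → Prop}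
    (f : α → β) {u v : α} (huv : Relation.ReflTransGen r u v) (hvu : Relation.ReflTransGen r v u)
    (hr : ∀ a b, r a b → Relation.ReflTransGen r u a → Relation.ReflTransGen r a u →
      Relation.ReflTransGen r u b → Relation.ReflTransGen r b u → r' (f a) (f b)) :
    Relation.ReflTransGen r' (f u) (f v) := by
  induction huv with
  | refl => exact .refl
  | tail hab hbc ih =>
    exact (ih (.head hbc hvu)).tail (hr _ _ hbc hab (.head hbc hvu) (hab.tail hbc) hvu)

namespace DiMultigraph

variable {α ε : Type*} [DecidableEq α] [DecidableEq ε]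

/-- `u` and `v` lie on a common closed walk. -/
def Mutual (G : DiMultigraph α ε) (u v : α) : Prop := G.Reaches u v ∧ G.Reaches v u

theorem Mutual.symm {G : DiMultigraph α ε} {u v : α} (h : G.Mutual u v) : G.Mutual v u :=
  ⟨h.2, h.1⟩

theorem SWalk.reaches {G : DiMultigraph α ε} {S : Finset α} {u v : α} {k : ℕ}
    (h : G.SWalk S u v k) : G.Reaches u v := by
  induction h with
  | nil _ => exact .refl
  | snoc he _ ih => exact ih.tail ⟨_, he, rfl, rfl⟩

theorem reaches_of_not_far {G : DiMultigraph α ε} {S : Finset α} {d : ℝ} {u v : α}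
    (h : ¬ G.Far S d u v) : G.Reaches u v := by
  by_contra hr
  apply h
  have : G.sdist S u v = ⊤ := by
    simp only [sdist, iInf_eq_top]
    exact fun k hk => absurd hk.reaches hr
  simp [Far, this]

theorem sdist_tgt_le (G : DiMultigraph α ε) (S : Finset α) (u : α) {e : ε} (he : e ∈ G.edges) :
    G.sdist S u (G.tgt e) ≤ G.sdist S u (G.src e) + if G.src e ∈ S then 1 else 0 := by
  rcases eq_or_ne (G.sdist S u (G.src e)) ⊤ with h | h
  · simp [h]
  · obtain ⟨k, hk, hk'⟩ : ∃ k : ℕ, G.SWalk S u (G.src e) k ∧ G.sdist S u (G.src e) = k := by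
      have hne : {k : ℕ | G.SWalk S u (G.src e) k}.Nonempty := by
        by_contra hemp
        apply h
        simp only [sdist, iInf_eq_top]
        exact fun k hk => absurd ⟨k, hk⟩ hemp
      refine ⟨_, Nat.sInf_mem hne, le_antisymm (iInf₂_le _ (Nat.sInf_mem hne)) ?_⟩
      exact le_iInf₂ fun k hk => by exact_mod_cast Nat.sInf_le hk
    rw [hk']
    refine (iInf₂_le _ (SWalk.snoc he hk)).trans (le_of_eq ?_)
    split_ifs <;> simp

/-- `T` is a balanced separator of `G`, whose side is closed under edges in one direction up to the
separator. -/
structure IsCut (G : DiMultigraph α ε) (S : Finset α) (d : ℝ) (T : Finset α × Finset α) :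
    Prop where
  sep_subset_verts : T.1 ⊆ G.verts
  sep_subset : T.1 ⊆ S
  side_subset : T.2 ⊆ G.verts
  disjoint : Disjoint T.1 T.2
  card_le : (T.1.card : ℝ) ≤ (min (T.2 ∩ S).card ((G.verts \ (T.1 ∪ T.2)) ∩ S).card : ℕ) *
    (2 * Real.log (G.verts.card : ℝ)) / d
  one_way : (∀ e ∈ G.edges, G.src e ∈ T.2 → G.tgt e ∈ T.1 ∪ T.2) ∨
    (∀ e ∈ G.edges, G.tgt e ∈ T.2 → G.src e ∈ T.1 ∪ T.2)

/-- Brings the cuts with parameters `d / 16`, `d / 4` and `δ / 2` to a common one. -/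
theorem IsCut.mono {G : DiMultigraph α ε} {S : Finset α} {d d' : ℝ} {T : Finset α × Finset α}
    (h : G.IsCut S d' T) (hd : 0 < d) (hdd : d ≤ d') : G.IsCut S d T :=
  { h with
    card_le := h.card_le.trans <| div_le_div_of_nonneg_left
      (mul_nonneg (Nat.cast_nonneg _) (mul_nonneg zero_le_two (Real.log_natCast_nonneg _))) hd hdd }

/-- Recursive calls restrict `S` to the side of the cut; as only the trace of `S` on the vertices
matters, all cuts can be measured against one fixed `S`. -/
theorem IsCut.congr {G : DiMultigraph α ε} {S S' : Finset α} {d : ℝ} {T : Finset α × Finset α}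
    (h : G.IsCut S d T) (hS : G.verts ∩ S = G.verts ∩ S') : G.IsCut S' d T := by
  have key : ∀ A ⊆ G.verts, A ∩ S = A ∩ S' := by
    intro A hA
    rw [← Finset.inter_eq_left.2 hA, Finset.inter_assoc, hS, ← Finset.inter_assoc]
  refine ⟨h.sep_subset_verts, ?_, h.side_subset, h.disjoint, ?_, h.one_way⟩
  · have := key _ h.sep_subset_verts
    rw [Finset.inter_eq_left.2 h.sep_subset] at this
    rw [this]
    exact Finset.inter_subset_right
  · have := h.card_le
    rwa [key _ h.side_subset, key _ Finset.sdiff_subset] at this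

theorem layerBalanced_sInf (G : DiMultigraph α ε) (r : α) (S : Finset α) {d : ℝ} (hd : 0 < d) :
    G.LayerBalanced r S d (sInf {i | G.LayerBalanced r S d i}) := by
  apply Nat.sInf_mem (s := {i | G.LayerBalanced r S d i})
  -- A number that is not the distance of any vertex has an empty layer, which is balanced. This
  -- makes the set nonempty, so that its `sInf` is a member and not the default 0.
  obtain ⟨i, hi⟩ := Infinite.exists_notMem_finset (G.verts.image fun v => (G.sdist S r v).toNat)
  refine ⟨i, ?_⟩
  have : G.layerSep r S i = ∅ := by
    rw [layerSep, Finset.filter_eq_empty_iff.2, Finset.empty_inter]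
    intro v hv h
    exact hi (Finset.mem_image.2 ⟨v, hv, by simp [h]⟩)
  have h0 := Real.log_natCast_nonneg G.verts.card
  simp only [Set.mem_ofPred_eq, LayerBalanced, this, Finset.card_empty, Nat.cast_zero]
  positivity

theorem isCut_layer (G : DiMultigraph α ε) (r : α) (S : Finset α) {d : ℝ} {i : ℕ}
    (h : G.LayerBalanced r S d i) : G.IsCut S d (G.layerSep r S i, G.layerSide r S i) where
  sep_subset_verts := Finset.inter_subset_left.trans (Finset.filter_subset _ _)
  sep_subset := Finset.inter_subset_right
  side_subset := Finset.sdiff_subset.trans (Finset.filter_subset _ _)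
  disjoint := Finset.disjoint_sdiff
  card_le := h
  one_way := by
    left
    intro e he hs
    have hle := G.sdist_tgt_le S r he
    simp only [layerSide, layerSep, Finset.mem_sdiff, Finset.mem_filter, Finset.mem_inter,
      Finset.mem_union] at hs ⊢
    have ht : G.sdist S r (G.tgt e) ≤ i := by
      refine hle.trans ?_
      split_ifs with hS
      · have hne : G.sdist S r (G.src e) ≠ i := fun h' => hs.2 ⟨⟨hs.1.1, h'⟩, hS⟩
        exact Order.add_one_le_of_lt (lt_of_le_of_ne hs.1.2 hne)
      · simpa using hs.1.2
    have := G.tgt_mem e he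
    tauto

theorem isCut_outSeparator (G : DiMultigraph α ε) (r : α) (S : Finset α) {d : ℝ} (hd : 0 < d) :
    G.IsCut S d (G.outSeparator r S d) :=
  G.isCut_layer r S (G.layerBalanced_sInf r S hd)

theorem isCut_inSeparator (G : DiMultigraph α ε) (r : α) (S : Finset α) {d : ℝ} (hd : 0 < d) :
    G.IsCut S d (G.inSeparator r S d) :=
  have h := G.reverse.isCut_outSeparator r S hd
  ⟨h.sep_subset_verts, h.sep_subset, h.side_subset, h.disjoint, h.card_le, h.one_way.symm⟩

theorem IsTwoWaySeparator.isCut {G : DiMultigraph α ε} {N : ℕ} {r : α} {S : Finset α} {d : ℝ}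
    {T : Finset α × Finset α} (h : G.IsTwoWaySeparator N r S d T) (hd : 0 < d) :
    G.IsCut S d T := by
  obtain ⟨A, B, h, rfl⟩ := h
  have h1 := G.isCut_outSeparator r S hd
  have h2 := G.isCut_inSeparator r S hd
  rcases h with ⟨rfl, rfl⟩ | ⟨rfl, rfl⟩ <;> split_ifs <;> assumption

theorem IsFarSeparator.isCut {G : DiMultigraph α ε} {S : Finset α} {r v : α} {d d' : ℝ}
    {T : Finset α × Finset α} (h : G.IsFarSeparator S r v d d' T) (hd : 0 < d') :
    G.IsCut S d' T := by
  rcases h with ⟨-, rfl⟩ | ⟨-, -, rfl⟩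
  · exact G.isCut_inSeparator v S hd
  · exact G.isCut_outSeparator v S hd

/-- Up to the separator vertices, no closed walk leaves the side of a cut. -/
theorem IsCut.mutual_mem {G : DiMultigraph α ε} {S Sep : Finset α} {d : ℝ}
    {T : Finset α × Finset α} (h : G.IsCut S d T) (hSep : T.1 ⊆ Sep) {u v : α}
    (huv : (G.removeIncident Sep).Mutual u v) (hu : u ∈ T.2) : v ∈ T.2 := by
  have key : ∀ e ∈ (G.removeIncident Sep).edges,
      e ∈ G.edges ∧ G.src e ∉ T.1 ∧ G.tgt e ∉ T.1 := by
    intro e he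
    obtain ⟨h1, h2, h3⟩ := Finset.mem_filter.1 he
    exact ⟨h1, fun h => h2 (hSep h), fun h => h3 (hSep h)⟩
  rcases h.one_way with hw | hw
  · have step : ∀ a b, (G.removeIncident Sep).Reaches a b → a ∈ T.2 → b ∈ T.2 := by
      intro a b hab ha
      induction hab with
      | refl => exact ha
      | tail _ hbc ih =>
        obtain ⟨e, he, rfl, rfl⟩ := hbc
        obtain ⟨h1, -, h3⟩ := key e he
        exact (Finset.mem_union.1 (hw e h1 ih)).resolve_left h3
    exact step _ _ huv.1 hu
  · have step : ∀ a b, (G.removeIncident Sep).Reaches a b → b ∈ T.2 → a ∈ T.2 := by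
      intro a b hab hb
      induction hab with
      | refl => exact hb
      | tail _ hbc ih =>
        obtain ⟨e, he, rfl, rfl⟩ := hbc
        obtain ⟨h1, h2, -⟩ := key e he
        exact ih ((Finset.mem_union.1 (hw e h1 hb)).resolve_left h2)
    exact step _ _ huv.2 hu

theorem eq_of_reaches_removeIncident_left {G : DiMultigraph α ε} {S : Finset α} {u v : α}
    (h : (G.removeIncident S).Reaches u v) (hu : u ∈ S) : u = v := by
  rcases Relation.ReflTransGen.cases_head h with h | ⟨c, ⟨e, he, rfl, rfl⟩, -⟩
  · exact h
  · exact absurd hu (Finset.mem_filter.1 he).2.1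

/-- Mutual reachability passes to every graph that keeps the edges inside a set which contains
everything mutually reachable from `u`. -/
theorem Mutual.of_subset {G G' : DiMultigraph α ε} {Q : Finset α} {u v : α} (h : G.Mutual u v)
    (hQ : ∀ w, G.Mutual u w → w ∈ Q)
    (hG : ∀ e ∈ G.edges, G.src e ∈ Q → G.tgt e ∈ Q →
      e ∈ G'.edges ∧ G'.src e = G.src e ∧ G'.tgt e = G.tgt e) : G'.Mutual u v := by
  have key : ∀ a b, G.Mutual u a → G.Mutual a b → G'.Reaches a b := by
    intro a b hua hab
    refine reflTransGen_map_of_mutual id hab.1 hab.2 ?_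
    rintro x y ⟨e, he, rfl, rfl⟩ h1 h2 h3 h4
    obtain ⟨k1, k2, k3⟩ := hG e he (hQ _ ⟨hua.1.trans h1, h2.trans hua.2⟩)
      (hQ _ ⟨hua.1.trans h3, h4.trans hua.2⟩)
    exact ⟨e, k1, k2, k3⟩
  exact ⟨key _ _ ⟨.refl, .refl⟩ h, key _ _ h h.symm⟩

/-! ### Repeated cutting and `Split` -/

/-- `Ψ` pays `c` for every separator vertex when a vertex set inside `U` is cut by a balanced
separator with parameter `d`. -/
structure PaysForCuts (U S : Finset α) (d : ℝ) (Ψ : Finset α → ℝ) (c : ℝ) : Prop where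
  cost_nonneg : 0 ≤ c
  nonneg : ∀ p, 0 ≤ Ψ p
  cut : ∀ T A B : Finset α, T ∪ A ∪ B ⊆ U → T ⊆ S → Disjoint T A → Disjoint (T ∪ A) B →
    (T.card : ℝ) ≤ (min (A ∩ S).card (B ∩ S).card : ℕ) *
      (2 * Real.log ((T ∪ A ∪ B).card : ℝ)) / d →
    Ψ A + Ψ B + ∑ s ∈ T, Ψ {s} + c * T.card ≤ Ψ (T ∪ A ∪ B)

/-- The outcome of repeatedly cutting `G`: the parts `P` form a partition, the separator vertices are
singleton parts, no strongly connected component of the graph without the edges at separators is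
torn apart, and the number of separator vertices is bounded by every potential. -/
structure Decomposes (G : DiMultigraph α ε) (S : Finset α) (d : ℝ) (Sep : Finset α)
    (P : Finset (Finset α)) : Prop where
  part_nonempty : ∀ p ∈ P, p.Nonempty
  cover : ∀ v, v ∈ G.verts ↔ ∃ p ∈ P, v ∈ p
  disj : ∀ p ∈ P, ∀ q ∈ P, ∀ v, v ∈ p → v ∈ q → p = q
  sep_subset : Sep ⊆ S
  sep_single : ∀ s ∈ Sep, {s} ∈ P
  same_part : ∀ u v, u ∈ G.verts → (G.removeIncident Sep).Mutual u v → ∃ p ∈ P, u ∈ p ∧ v ∈ p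
  pays : ∀ U Ψ c, PaysForCuts U S d Ψ c → G.verts ⊆ U →
    ∑ p ∈ P, Ψ p + c * Sep.card ≤ Ψ G.verts

theorem decomposes_whole (G : DiMultigraph α ε) (S : Finset α) (d : ℝ) :
    G.Decomposes S d ∅ (({G.verts} : Finset (Finset α)).erase ∅) where
  part_nonempty p hp := Finset.nonempty_iff_ne_empty.2 (Finset.mem_erase.1 hp).1
  cover v := by
    constructor
    · intro hv
      refine ⟨G.verts, ?_, hv⟩
      simp only [Finset.mem_erase, Finset.mem_singleton, and_true]
      rintro h
      simp [h] at hv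
    · rintro ⟨p, hp, hv⟩
      rw [← Finset.mem_singleton.1 (Finset.mem_erase.1 hp).2]
      exact hv
  disj p hp q hq v _ _ := by
    rw [Finset.mem_singleton.1 (Finset.mem_erase.1 hp).2,
      Finset.mem_singleton.1 (Finset.mem_erase.1 hq).2]
  sep_subset := Finset.empty_subset _
  sep_single s hs := absurd hs (Finset.notMem_empty s)
  same_part u v hu h := by
    have hv : v ∈ G.verts := by
      rcases Relation.ReflTransGen.cases_tail h.1 with rfl | ⟨c, -, ⟨e, he, -, rfl⟩⟩
      · exact hu
      · exact G.tgt_mem e (Finset.mem_filter.1 he).1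
    refine ⟨G.verts, ?_, hu, hv⟩
    simp only [Finset.mem_erase, Finset.mem_singleton, and_true]
    rintro h
    simp [h] at hv
  pays U Ψ c h _ := by
    have h1 : ∑ p ∈ (({G.verts} : Finset (Finset α)).erase ∅), Ψ p ≤ ∑ p ∈ {G.verts}, Ψ p :=
      Finset.sum_le_sum_of_subset_of_nonneg (Finset.erase_subset _ _) fun p _ _ => h.nonneg p
    simpa using h1

theorem sum_union_le_add {ι : Type*} [DecidableEq ι] {f : ι → ℝ} (hf : ∀ i, 0 ≤ f i)
    (s t : Finset ι) : ∑ i ∈ s ∪ t, f i ≤ ∑ i ∈ s, f i + ∑ i ∈ t, f i := by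
  rw [← Finset.sum_union_inter]
  exact le_add_of_nonneg_right (Finset.sum_nonneg fun i _ => hf i)

theorem verts_eq_cut {G : DiMultigraph α ε} {S : Finset α} {d : ℝ} {T : Finset α × Finset α}
    (h : G.IsCut S d T) : T.1 ∪ T.2 ∪ (G.verts \ (T.1 ∪ T.2)) = G.verts :=
  Finset.union_sdiff_of_subset (Finset.union_subset h.sep_subset_verts h.side_subset)

/-- The induction step for every use of a separator. Separator vertices become isolated, a strongly
connected class that meets the side stays in it by `IsCut.mutual_mem`, and hence one that meets the
rest stays in the rest. The costs add up by the cut condition of the potential. -/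
theorem IsCut.decomposes {G : DiMultigraph α ε} {S : Finset α} {d : ℝ} {T : Finset α × Finset α}
    (h : G.IsCut S d T) {Sep₁ Sep₂ : Finset α} {P₁ P₂ : Finset (Finset α)}
    (h₁ : (G.induce T.2).Decomposes S d Sep₁ P₁)
    (h₂ : (G.induce (G.verts \ (T.1 ∪ T.2))).Decomposes S d Sep₂ P₂) :
    G.Decomposes S d (T.1 ∪ Sep₁ ∪ Sep₂) (P₁ ∪ T.1.image (fun s => {s}) ∪ P₂) := by
  have hV₁ : (G.induce T.2).verts = T.2 := Finset.inter_eq_right.2 h.side_subset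
  have hV₂ : (G.induce (G.verts \ (T.1 ∪ T.2))).verts = G.verts \ (T.1 ∪ T.2) :=
    Finset.inter_eq_right.2 Finset.sdiff_subset
  have c₁ := h₁.cover
  have c₂ := h₂.cover
  rw [hV₁] at c₁
  rw [hV₂] at c₂
  have hd : ∀ v, v ∈ T.1 → v ∉ T.2 := fun v h1 h2 => Finset.disjoint_left.1 h.disjoint h1 h2
  have hP : ∀ p, p ∈ P₁ ∪ T.1.image (fun s => ({s} : Finset α)) ∪ P₂ ↔
      p ∈ P₁ ∨ (∃ s ∈ T.1, {s} = p) ∨ p ∈ P₂ := by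
    intro p
    simp only [Finset.mem_union, Finset.mem_image, or_assoc]
  refine ⟨?_, ?_, ?_, ?_, ?_, ?_, ?_⟩
  · intro p hp
    rcases (hP p).1 hp with hp | ⟨s, -, rfl⟩ | hp
    · exact h₁.part_nonempty p hp
    · exact Finset.singleton_nonempty s
    · exact h₂.part_nonempty p hp
  · intro v
    constructor
    · intro hv
      by_cases hv1 : v ∈ T.1
      · exact ⟨{v}, (hP _).2 (.inr (.inl ⟨v, hv1, rfl⟩)), Finset.mem_singleton_self v⟩
      by_cases hv2 : v ∈ T.2
      · obtain ⟨p, hp, hvp⟩ := (c₁ v).1 hv2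
        exact ⟨p, (hP _).2 (.inl hp), hvp⟩
      · obtain ⟨p, hp, hvp⟩ := (c₂ v).1 (by simp [hv, hv1, hv2])
        exact ⟨p, (hP _).2 (.inr (.inr hp)), hvp⟩
    · rintro ⟨p, hp, hvp⟩
      rcases (hP p).1 hp with hp | ⟨s, hs, rfl⟩ | hp
      · exact h.side_subset ((c₁ v).2 ⟨p, hp, hvp⟩)
      · rw [Finset.mem_singleton.1 hvp]
        exact h.sep_subset_verts hs
      · exact (Finset.mem_sdiff.1 ((c₂ v).2 ⟨p, hp, hvp⟩)).1
  · intro p hp q hq v hvp hvq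
    have d₁ : ∀ p ∈ P₁, v ∈ p → v ∈ T.2 := fun p hp hv => (c₁ v).2 ⟨p, hp, hv⟩
    have d₂ : ∀ p ∈ P₂, v ∈ p → v ∉ T.1 ∧ v ∉ T.2 := by
      intro p hp hv
      simpa using (Finset.mem_sdiff.1 ((c₂ v).2 ⟨p, hp, hv⟩)).2
    rcases (hP p).1 hp with hp | ⟨s, hs, rfl⟩ | hp <;>
      rcases (hP q).1 hq with hq | ⟨t, ht, rfl⟩ | hq
    · exact h₁.disj p hp q hq v hvp hvq
    · exact absurd (d₁ p hp hvp) (hd _ (Finset.mem_singleton.1 hvq ▸ ht))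
    · exact absurd (d₁ p hp hvp) (d₂ q hq hvq).2
    · exact absurd (d₁ q hq hvq) (hd _ (Finset.mem_singleton.1 hvp ▸ hs))
    · rw [← Finset.mem_singleton.1 hvp, ← Finset.mem_singleton.1 hvq]
    · exact absurd (Finset.mem_singleton.1 hvp ▸ hs) (d₂ q hq hvq).1
    · exact absurd (d₁ q hq hvq) (d₂ p hp hvp).2
    · exact absurd (Finset.mem_singleton.1 hvq ▸ ht) (d₂ p hp hvp).1
    · exact h₂.disj p hp q hq v hvp hvq
  · exact Finset.union_subset (Finset.union_subset h.sep_subset h₁.sep_subset) h₂.sep_subset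
  · intro s hs
    rw [hP]
    rcases Finset.mem_union.1 hs with hs | hs
    · rcases Finset.mem_union.1 hs with hs | hs
      · exact .inr (.inl ⟨s, hs, rfl⟩)
      · exact .inl (h₁.sep_single s hs)
    · exact .inr (.inr (h₂.sep_single s hs))
  · intro u v hu huv
    set R := G.removeIncident (T.1 ∪ Sep₁ ∪ Sep₂) with hR
    have hT : T.1 ⊆ T.1 ∪ Sep₁ ∪ Sep₂ :=
      Finset.subset_union_left.trans Finset.subset_union_left
    by_cases hu1 : u ∈ T.1
    · have := eq_of_reaches_removeIncident_left huv.1 (hT hu1)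
      subst this
      exact ⟨{u}, (hP _).2 (.inr (.inl ⟨u, hu1, rfl⟩)), by simp, by simp⟩
    by_cases hu2 : u ∈ T.2
    · obtain ⟨p, hp, hup, hvp⟩ := h₁.same_part u v (by rw [hV₁]; exact hu2) <| huv.of_subset (Q := T.2)
        (fun w hw => h.mutual_mem hT hw hu2) (by
          intro e he hs ht
          refine ⟨?_, rfl, rfl⟩
          obtain ⟨k1, k2, k3⟩ := Finset.mem_filter.1 he
          refine Finset.mem_filter.2 ⟨Finset.mem_filter.2 ⟨k1, hs, ht⟩, fun k => k2 ?_, fun k => k3 ?_⟩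
          · exact Finset.mem_union_left _ (Finset.mem_union_right _ k)
          · exact Finset.mem_union_left _ (Finset.mem_union_right _ k))
      exact ⟨p, (hP _).2 (.inl hp), hup, hvp⟩
    · have hu3 : u ∈ G.verts \ (T.1 ∪ T.2) := by simp [hu, hu1, hu2]
      obtain ⟨p, hp, hup, hvp⟩ := h₂.same_part u v (by rw [hV₂]; exact hu3) <|
        huv.of_subset (Q := G.verts \ (T.1 ∪ T.2)) (fun w hw => by
          have hw1 : w ∉ T.1 := by
            intro hw1
            rw [eq_of_reaches_removeIncident_left hw.2 (hT hw1)] at hw1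
            exact hu1 hw1
          have hw2 : w ∉ T.2 := fun hw2 => hu2 (h.mutual_mem hT hw.symm hw2)
          have hw3 : w ∈ G.verts := by
            rcases Relation.ReflTransGen.cases_tail hw.1 with rfl | ⟨c, -, ⟨e, he, -, rfl⟩⟩
            · exact hu
            · exact G.tgt_mem e (Finset.mem_filter.1 he).1
          simp [hw1, hw2, hw3]) (by
          intro e he hs ht
          refine ⟨?_, rfl, rfl⟩
          obtain ⟨k1, k2, k3⟩ := Finset.mem_filter.1 he
          refine Finset.mem_filter.2 ⟨Finset.mem_filter.2 ⟨k1, hs, ht⟩, fun k => k2 ?_, fun k => k3 ?_⟩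
          · exact Finset.mem_union_right _ k
          · exact Finset.mem_union_right _ k)
      exact ⟨p, (hP _).2 (.inr (.inr hp)), hup, hvp⟩
  · intro U Ψ c hΨ hU
    have e₁ := h₁.pays U Ψ c hΨ (by rw [hV₁]; exact h.side_subset.trans hU)
    have e₂ := h₂.pays U Ψ c hΨ (by rw [hV₂]; exact Finset.sdiff_subset.trans hU)
    rw [hV₁] at e₁
    rw [hV₂] at e₂
    have hV := verts_eq_cut h
    have e₃ := hΨ.cut T.1 T.2 (G.verts \ (T.1 ∪ T.2)) (hV.symm ▸ hU) h.sep_subset h.disjoint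
      Finset.disjoint_sdiff (hV.symm ▸ h.card_le)
    rw [hV] at e₃
    -- Only upper bounds are wanted and `Ψ` is nonnegative, so the unions need not be shown
    -- disjoint.
    have s₁ := sum_union_le_add hΨ.nonneg (P₁ ∪ T.1.image (fun s => {s})) P₂
    have s₂ := sum_union_le_add hΨ.nonneg P₁ (T.1.image (fun s => {s}))
    rw [Finset.sum_image (fun a _ b _ hab => Finset.singleton_injective hab)] at s₂
    have k : ((T.1 ∪ Sep₁ ∪ Sep₂).card : ℝ) ≤ T.1.card + Sep₁.card + Sep₂.card := by
      exact_mod_cast (Finset.card_union_le _ _).trans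
        (Nat.add_le_add_right (Finset.card_union_le _ _) _)
    have k' := mul_le_mul_of_nonneg_left k hΨ.cost_nonneg
    linarith

theorem inter_eq_inter_of_verts {A B S S' : Finset α} (hAB : A ⊆ B) (h : B ∩ S = B ∩ S') :
    A ∩ S = A ∩ S' := by
  rw [← Finset.inter_eq_left.2 hAB, Finset.inter_assoc, h, ← Finset.inter_assoc]

theorem inter_inter_eq_of_verts {A B S S' : Finset α} (h : B ∩ S = B ∩ S') :
    B ∩ A ∩ (A ∩ S) = B ∩ A ∩ S' := by
  rw [← Finset.inter_assoc, Finset.inter_assoc B A A, Finset.inter_self]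
  exact inter_eq_inter_of_verts Finset.inter_subset_left h

theorem SplitRun.decomposes {d : ℝ} (hd : 0 < d) {mode : SplitMode α} {G : DiMultigraph α ε}
    {S Sep : Finset α} {P : Finset (Finset α)} (h : SplitRun d mode G S Sep P) (S₀ : Finset α)
    (hS : G.verts ∩ S = G.verts ∩ S₀) : G.Decomposes S₀ (d / 16) Sep P := by
  induction h with
  | @finish N G S hG =>
    have := G.decomposes_whole S₀ (d / 16)
    rwa [hG, Finset.erase_singleton] at this
  | @cut N G S r T Sep₁ Sep₂ P₁ P₂ hr hT hsmall hrec hrest ih₁ ih₂ =>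
    have hc := (hT.isCut (by positivity)).congr hS
    rw [Finset.union_comm T.2 T.1] at ih₂
    refine hc.decomposes (ih₁ ?_) (ih₂ ?_)
    · exact inter_inter_eq_of_verts hS
    · exact inter_eq_inter_of_verts Finset.inter_subset_left hS
  | tree hr hT hlarge hrun ih => exact ih hS
  | @far r G S v T Sep₁ Sep₂ P₁ P₂ hv hT hrec hrest ih₁ ih₂ =>
    have hc₀ : G.IsCut S (d / 4) T := hT.isCut (by positivity)
    have hc : G.IsCut S₀ (d / 16) T := (hc₀.congr hS).mono (by positivity) (by linarith)
    refine hc.decomposes (ih₁ ?_) (ih₂ ?_)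
    · exact inter_inter_eq_of_verts hS
    · exact inter_eq_inter_of_verts Finset.inter_subset_left hS
  | close hclose => exact decomposes_whole _ _ _

theorem Reaches.of_edges {G G' : DiMultigraph α ε} {u v : α} (h : G.Reaches u v)
    (hG : ∀ e ∈ G.edges, e ∈ G'.edges ∧ G'.src e = G.src e ∧ G'.tgt e = G.tgt e) :
    G'.Reaches u v := by
  refine Relation.ReflTransGen.mono ?_ _ _ h
  rintro a b ⟨e, he, rfl, rfl⟩
  exact ⟨e, hG e he⟩

/-- A part left by the inner loop consists of vertices at finite distance from and to the root of
the tree, and all other parts are singletons. This is what makes the levels connected right after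
preprocessing, where no distance check has been run yet. -/
theorem SplitRun.reaches {d : ℝ} {mode : SplitMode α} {G : DiMultigraph α ε}
    {S Sep : Finset α} {P : Finset (Finset α)} (h : SplitRun d mode G S Sep P) :
    ∀ p ∈ P, ∀ u ∈ p, ∀ v ∈ p, (G.induce p).Reaches u v := by
  have sub : ∀ (G : DiMultigraph α ε) (X p : Finset α) (u v : α),
      ((G.induce X).induce p).Reaches u v → (G.induce p).Reaches u v := by
    intro G X p u v h
    refine h.of_edges fun e he => ⟨?_, rfl, rfl⟩
    obtain ⟨h1, h2⟩ := Finset.mem_filter.1 he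
    exact Finset.mem_filter.2 ⟨(Finset.mem_filter.1 h1).1, h2⟩
  have comb : ∀ (G : DiMultigraph α ε) (X Y T : Finset α) (P₁ P₂ : Finset (Finset α)),
      (∀ p ∈ P₁, ∀ u ∈ p, ∀ v ∈ p, ((G.induce X).induce p).Reaches u v) →
      (∀ p ∈ P₂, ∀ u ∈ p, ∀ v ∈ p, ((G.induce Y).induce p).Reaches u v) →
      ∀ p ∈ P₁ ∪ T.image (fun s => {s}) ∪ P₂, ∀ u ∈ p, ∀ v ∈ p, (G.induce p).Reaches u v := by
    intro G X Y T P₁ P₂ h₁ h₂ p hp u hu v hv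
    simp only [Finset.mem_union, Finset.mem_image] at hp
    rcases hp with (hp | ⟨s, -, rfl⟩) | hp
    · exact sub _ _ _ _ _ (h₁ p hp u hu v hv)
    · rw [Finset.mem_singleton.1 hu, Finset.mem_singleton.1 hv]
      exact .refl
    · exact sub _ _ _ _ _ (h₂ p hp u hu v hv)
  induction h with
  | finish hG => exact fun p hp => absurd hp (Finset.notMem_empty p)
  | cut hr hT hsmall hrec hrest ih₁ ih₂ => exact comb _ _ _ _ _ _ ih₁ ih₂
  | tree hr hT hlarge hrun ih => exact ih
  | far hv hT hrec hrest ih₁ ih₂ => exact comb _ _ _ _ _ _ ih₁ ih₂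
  | @close r G S hclose =>
    intro p hp u hu v hv
    obtain rfl := Finset.mem_singleton.1 (Finset.mem_erase.1 hp).2
    have := (reaches_of_not_far (hclose u hu).2).trans (reaches_of_not_far (hclose v hv).1)
    refine Reaches.of_edges this fun e he => ⟨?_, rfl, rfl⟩
    exact Finset.mem_filter.2 ⟨he, G.src_mem e he, G.tgt_mem e he⟩

end DiMultigraph

/-! ### Partitions, flattening, and potentials on sets of nodes -/

section Families

variable {V : Type*} [DecidableEq V]

theorem mem_flatten {F : Finset (Finset V)} {v : V} : v ∈ flatten F ↔ ∃ Y ∈ F, v ∈ Y := by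
  simp [flatten, Finset.mem_sup]

theorem mem_singleNodes {S : Finset V} {Y : Finset V} : Y ∈ singleNodes S ↔ ∃ v ∈ S, {v} = Y := by
  simp [singleNodes]

theorem flatten_singleton (Y : Finset V) : flatten {Y} = Y := by simp [flatten]

theorem flatten_union (A B : Finset (Finset V)) : flatten (A ∪ B) = flatten A ∪ flatten B :=
  Finset.sup_union

theorem flatten_mono {A B : Finset (Finset V)} (h : A ⊆ B) : flatten A ⊆ flatten B :=
  Finset.sup_mono h

theorem singleton_mem_of_mem_flatten {S : Finset V} {F : Finset (Finset V)} (hF : F ⊆ singleNodes S)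
    {v : V} (hv : v ∈ flatten F) : {v} ∈ F ∧ v ∈ S := by
  obtain ⟨Y, hY, hvY⟩ := mem_flatten.1 hv
  obtain ⟨s, hs, rfl⟩ := mem_singleNodes.1 (hF hY)
  rw [Finset.mem_singleton.1 hvY]
  exact ⟨hY, hs⟩

theorem card_flatten_of_subset_singleNodes {S : Finset V} {F : Finset (Finset V)}
    (hF : F ⊆ singleNodes S) : (flatten F).card = F.card := by
  rw [← Finset.card_image_of_injective (flatten F) (Finset.singleton_injective (α := V))]
  congr 1
  ext Y
  simp only [Finset.mem_image]
  constructor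
  · rintro ⟨v, hv, rfl⟩
    exact (singleton_mem_of_mem_flatten hF hv).1
  · intro hY
    obtain ⟨s, hs, rfl⟩ := mem_singleNodes.1 (hF hY)
    exact ⟨s, mem_flatten.2 ⟨_, hY, Finset.mem_singleton_self s⟩, rfl⟩

/-- `P` is a partition of `X` into nonempty sets. -/
structure IsPartition (P : Finset (Finset V)) (X : Finset V) : Prop where
  part_nonempty : ∀ p ∈ P, p.Nonempty
  cover : ∀ v, v ∈ X ↔ ∃ p ∈ P, v ∈ p
  disj : ∀ p ∈ P, ∀ q ∈ P, ∀ v, v ∈ p → v ∈ q → p = q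

namespace IsPartition

variable {P : Finset (Finset V)} {X : Finset V}

theorem subset (h : IsPartition P X) {p : Finset V} (hp : p ∈ P) : p ⊆ X :=
  fun v hv => (h.cover v).2 ⟨p, hp, hv⟩

theorem flatten_eq (h : IsPartition P X) : flatten P = X := by
  ext v; rw [mem_flatten, h.cover]

theorem nodeOf_eq (h : IsPartition P X) {p : Finset V} (hp : p ∈ P) {v : V} (hv : v ∈ p) :
    DiMultigraph.nodeOf P v = p := by
  have : P.filter (fun q => v ∈ q) = {p} := by
    ext q
    simp only [Finset.mem_filter, Finset.mem_singleton]
    exact ⟨fun hq => h.disj q hq.1 p hp v hq.2 hv, fun hq => hq ▸ ⟨hp, hv⟩⟩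
  rw [DiMultigraph.nodeOf, this, Finset.sup_singleton, id]

theorem nodeOf_mem (h : IsPartition P X) {v : V} (hv : v ∈ X) :
    DiMultigraph.nodeOf P v ∈ P ∧ v ∈ DiMultigraph.nodeOf P v := by
  obtain ⟨p, hp, hvp⟩ := (h.cover v).1 hv
  rw [h.nodeOf_eq hp hvp]
  exact ⟨hp, hvp⟩

theorem mem_of_mem_flatten (h : IsPartition P X) {A : Finset (Finset V)} (hA : A ⊆ P)
    {p : Finset V} (hp : p ∈ P) {v : V} (hv : v ∈ p) (hvA : v ∈ flatten A) : p ∈ A := by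
  obtain ⟨q, hq, hvq⟩ := mem_flatten.1 hvA
  rwa [h.disj p hp q (hA hq) v hv hvq]

theorem restrict (h : IsPartition P X) {A : Finset (Finset V)} (hA : A ⊆ P) :
    IsPartition A (flatten A) :=
  ⟨fun p hp => h.part_nonempty p (hA hp), fun _ => mem_flatten,
    fun p hp q hq => h.disj p (hA hp) q (hA hq)⟩

theorem disjoint_flatten (h : IsPartition P X) {A B : Finset (Finset V)} (hA : A ⊆ P) (hB : B ⊆ P)
    (hAB : Disjoint A B) : Disjoint (flatten A) (flatten B) := by
  rw [Finset.disjoint_left]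
  intro v hvA hvB
  obtain ⟨p, hp, hvp⟩ := mem_flatten.1 hvA
  exact Finset.disjoint_left.1 hAB hp (h.mem_of_mem_flatten hB (hA hp) hvp hvB)

theorem flatten_sdiff (h : IsPartition P X) {A : Finset (Finset V)} (hA : A ⊆ P) :
    flatten (P \ A) = X \ flatten A := by
  ext v
  rw [mem_flatten, Finset.mem_sdiff, h.cover]
  constructor
  · rintro ⟨p, hp, hv⟩
    obtain ⟨hp1, hp2⟩ := Finset.mem_sdiff.1 hp
    exact ⟨⟨p, hp1, hv⟩, fun hvA => hp2 (h.mem_of_mem_flatten hA hp1 hv hvA)⟩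
  · rintro ⟨⟨p, hp, hv⟩, hvA⟩
    exact ⟨p, Finset.mem_sdiff.2 ⟨hp, fun hpA => hvA (mem_flatten.2 ⟨p, hpA, hv⟩)⟩, hv⟩

theorem card_le (h : IsPartition P X) : P.card ≤ X.card := by
  have hsub : P ⊆ X.image (DiMultigraph.nodeOf P) := by
    intro p hp
    obtain ⟨v, hv⟩ := h.part_nonempty p hp
    exact Finset.mem_image.2 ⟨v, h.subset hp hv, h.nodeOf_eq hp hv⟩
  exact (Finset.card_le_card hsub).trans Finset.card_image_le

theorem sum_card_inter (h : IsPartition P X) {S : Finset V} (hS : S ⊆ X) :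
    ∑ p ∈ P, (p ∩ S).card = S.card := by
  rw [← Finset.card_biUnion]
  · congr 1
    ext v
    simp only [Finset.mem_biUnion, Finset.mem_inter]
    constructor
    · rintro ⟨p, -, -, hv⟩
      exact hv
    · intro hv
      obtain ⟨p, hp, hvp⟩ := (h.cover v).1 (hS hv)
      exact ⟨p, hp, hvp, hv⟩
  · intro p hp q hq hpq
    rw [Function.onFun, Finset.disjoint_left]
    intro v hv hv'
    exact hpq (h.disj p hp q hq v (Finset.mem_inter.1 hv).1 (Finset.mem_inter.1 hv').1)

/-- Replacing a part by a partition of it. -/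
theorem replace (h : IsPartition P X) {Y : Finset V} (hY : Y ∈ P) {R : Finset (Finset V)}
    (hR : IsPartition R Y) : IsPartition (P.erase Y ∪ R) X := by
  refine ⟨?_, ?_, ?_⟩
  · intro p hp
    rcases Finset.mem_union.1 hp with hp | hp
    · exact h.part_nonempty p (Finset.mem_of_mem_erase hp)
    · exact hR.part_nonempty p hp
  · intro v
    constructor
    · intro hv
      obtain ⟨p, hp, hvp⟩ := (h.cover v).1 hv
      by_cases hpY : p = Y
      · obtain ⟨q, hq, hvq⟩ := (hR.cover v).1 (hpY ▸ hvp)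
        exact ⟨q, Finset.mem_union_right _ hq, hvq⟩
      · exact ⟨p, Finset.mem_union_left _ (Finset.mem_erase.2 ⟨hpY, hp⟩), hvp⟩
    · rintro ⟨p, hp, hvp⟩
      rcases Finset.mem_union.1 hp with hp | hp
      · exact h.subset (Finset.mem_of_mem_erase hp) hvp
      · exact h.subset hY (hR.subset hp hvp)
  · have key : ∀ p ∈ P.erase Y, ∀ q ∈ R, ∀ v, v ∈ p → v ∉ q := by
      intro p hp q hq v hvp hvq
      obtain ⟨h1, h2⟩ := Finset.mem_erase.1 hp
      exact h1 (h.disj p h2 Y hY v hvp (hR.subset hq hvq))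
    intro p hp q hq v hvp hvq
    rcases Finset.mem_union.1 hp with hp | hp <;> rcases Finset.mem_union.1 hq with hq | hq
    · exact h.disj p (Finset.mem_of_mem_erase hp) q (Finset.mem_of_mem_erase hq) v hvp hvq
    · exact absurd hvq (key p hp q hq v hvp)
    · exact absurd hvp (key q hq p hp v hvq)
    · exact hR.disj p hp q hq v hvp hvq

/-- The vertices of `D` are added one at a time; each changes the term of only one part, and
`IsPotential.grow` compares that change with the one on the other side. -/
theorem sum_grow (h : IsPartition P X) {d : ℝ} {φ : ℕ → ℕ → ℝ} {c : ℝ}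
    (hφ : IsPotential X.card d φ c) (S D : Finset V) (hX : S ∪ D ⊆ X) :
    ∑ p ∈ P, φ (p ∩ (S ∪ D)).card p.card + φ S.card X.card ≤
      ∑ p ∈ P, φ (p ∩ S).card p.card + φ (S ∪ D).card X.card := by
  induction D using Finset.induction_on with
  | empty => simp
  | insert a D ha ih =>
    rw [Finset.union_insert] at hX ⊢
    have ih := ih ((Finset.subset_insert _ _).trans hX)
    set W := S ∪ D with hW
    by_cases haW : a ∈ W
    · rwa [Finset.insert_eq_of_mem haW]
    obtain ⟨p, hp, hap⟩ := (h.cover a).1 (hX (Finset.mem_insert_self _ _))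
    have hsum : ∑ q ∈ P.erase p, φ (q ∩ insert a W).card q.card =
        ∑ q ∈ P.erase p, φ (q ∩ W).card q.card := by
      refine Finset.sum_congr rfl fun q hq => ?_
      obtain ⟨h1, h2⟩ := Finset.mem_erase.1 hq
      rw [Finset.inter_insert_of_notMem fun haq => h1 (h.disj q h2 p hp a haq hap)]
    rw [← Finset.add_sum_erase _ _ hp] at ih ⊢
    rw [hsum, Finset.inter_insert_of_mem hap,
      Finset.card_insert_of_notMem (fun h => haW (Finset.mem_inter.1 h).2),
      Finset.card_insert_of_notMem haW]
    have := hφ.grow (p ∩ W).card W.card p.card (Finset.card_le_card Finset.inter_subset_right)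
      (Finset.card_le_card (h.subset hp))
    linarith

end IsPartition

/-- Separator vertices are nodes by themselves, so counting separator nodes is counting separator
vertices. -/
theorem card_inter_singleNodes {P : Finset (Finset V)} {X S : Finset V} (h : IsPartition P X)
    (hS : ∀ v ∈ S, {v} ∈ P) {A : Finset (Finset V)} (hA : A ⊆ P) :
    (A ∩ singleNodes S).card = (flatten A ∩ S).card := by
  rw [← card_flatten_of_subset_singleNodes (S := S) Finset.inter_subset_right]
  congr 1
  ext v
  constructor
  · intro hv
    exact Finset.mem_inter.2 ⟨flatten_mono Finset.inter_subset_left hv,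
      (singleton_mem_of_mem_flatten Finset.inter_subset_right hv).2⟩
  · intro hv
    obtain ⟨h1, h2⟩ := Finset.mem_inter.1 hv
    have := h.mem_of_mem_flatten hA (hS v h2) (Finset.mem_singleton_self v) h1
    exact mem_flatten.2 ⟨{v}, Finset.mem_inter.2 ⟨this, mem_singleNodes.2 ⟨v, h2, rfl⟩⟩,
      Finset.mem_singleton_self v⟩

/-- A potential on vertex sets induces one on sets of nodes. -/
theorem IsPotential.paysForCuts {n : ℕ} {d : ℝ} (hd : 0 < d) {φ : ℕ → ℕ → ℝ} {c : ℝ}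
    (hφ : IsPotential n d φ c) {P : Finset (Finset V)} {X S : Finset V} (h : IsPartition P X)
    (hX : X.card ≤ n) (hS : ∀ v ∈ S, {v} ∈ P) :
    DiMultigraph.PaysForCuts P (singleNodes S) d
      (fun p => φ (flatten p ∩ S).card (flatten p).card) c where
  cost_nonneg := hφ.cost_nonneg
  nonneg _ := hφ.nonneg _ _
  cut T A B hU hT hTA hTAB hcard := by
    have hTP : T ⊆ P := (Finset.subset_union_left.trans Finset.subset_union_left).trans hU
    have hAP : A ⊆ P := (Finset.subset_union_right.trans Finset.subset_union_left).trans hU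
    have hBP : B ⊆ P := Finset.subset_union_right.trans hU
    have d1 := h.disjoint_flatten hTP hAP hTA
    have d2 := h.disjoint_flatten (Finset.union_subset hTP hAP) hBP hTAB
    have hTcard := card_flatten_of_subset_singleNodes hT
    have hTS : flatten T ∩ S = flatten T :=
      Finset.inter_eq_left.2 fun v hv => (singleton_mem_of_mem_flatten hT hv).2
    have hN : (flatten (T ∪ A ∪ B)).card = (flatten A).card + (flatten B).card + T.card := by
      rw [flatten_union, Finset.card_union_of_disjoint d2, flatten_union,
        Finset.card_union_of_disjoint d1, hTcard]
      omega
    have hx : (flatten (T ∪ A ∪ B) ∩ S).card =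
        (flatten A ∩ S).card + (flatten B ∩ S).card + T.card := by
      rw [flatten_union, Finset.union_inter_distrib_right, Finset.card_union_of_disjoint
        (d2.mono Finset.inter_subset_left Finset.inter_subset_left), flatten_union,
        Finset.union_inter_distrib_right, Finset.card_union_of_disjoint
        (d1.mono Finset.inter_subset_left Finset.inter_subset_left), hTS, hTcard]
      omega
    have hsing : ∀ s ∈ T, φ (flatten {s} ∩ S).card (flatten {s}).card = φ 1 1 := by
      intro s hs
      obtain ⟨v, hv, rfl⟩ := mem_singleNodes.1 (hT hs)
      rw [flatten_singleton, Finset.singleton_inter_of_mem hv, Finset.card_singleton]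
    rw [Finset.sum_congr rfl hsing, Finset.sum_const, nsmul_eq_mul, hN, hx]
    refine hφ.cut _ _ _ _ _ (Finset.card_le_card Finset.inter_subset_left)
      (Finset.card_le_card Finset.inter_subset_left) ?_ ?_
    · rw [← hN]
      refine (Finset.card_le_card ?_).trans hX
      rw [← h.flatten_eq]
      exact flatten_mono hU
    · rw [card_inter_singleNodes h hS hAP, card_inter_singleNodes h hS hBP] at hcard
      refine hcard.trans ?_
      -- The balance condition of the search uses the number of nodes, the potential the number of
      -- vertices. Nodes are nonempty and disjoint, so there are at most as many of them.
      have : Real.log ((T ∪ A ∪ B).card : ℝ) ≤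
          Real.log (((flatten A).card + (flatten B).card + T.card : ℕ) : ℝ) := by
        rcases Nat.eq_zero_or_pos (T ∪ A ∪ B).card with h0 | h0
        · rw [h0, Nat.cast_zero, Real.log_zero]
          exact Real.log_natCast_nonneg _
        · refine Real.log_le_log (by exact_mod_cast h0) ?_
          rw [← hN]
          exact_mod_cast (h.restrict hU).card_le
      gcongr

end Families

/-! ### Decompositions of a contracted graph, read on the vertices -/

namespace DiMultigraph

variable {V ε : Type*} [DecidableEq V] [DecidableEq ε]

theorem removeIncident_empty (G : DiMultigraph V ε) : G.removeIncident ∅ = G := by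
  cases G
  simp [removeIncident, filterEdges]

theorem Reaches.mono_removeIncident {G : DiMultigraph V ε} {S S' : Finset V} (h : S ⊆ S') {u v : V}
    (huv : (G.removeIncident S').Reaches u v) : (G.removeIncident S).Reaches u v := by
  refine huv.of_edges fun e he => ⟨?_, rfl, rfl⟩
  obtain ⟨h1, h2, h3⟩ := Finset.mem_filter.1 he
  exact Finset.mem_filter.2 ⟨h1, fun k => h2 (h k), fun k => h3 (h k)⟩

theorem Mutual.mono_removeIncident {G : DiMultigraph V ε} {S S' : Finset V} (h : S ⊆ S') {u v : V}
    (huv : (G.removeIncident S').Mutual u v) : (G.removeIncident S).Mutual u v :=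
  ⟨huv.1.mono_removeIncident h, huv.2.mono_removeIncident h⟩

theorem Reaches.mem_verts {G : DiMultigraph V ε} {u v : V} (h : G.Reaches u v)
    (hu : u ∈ G.verts) : v ∈ G.verts := by
  rcases Relation.ReflTransGen.cases_tail h with rfl | ⟨c, -, ⟨e, he, -, rfl⟩⟩
  · exact hu
  · exact G.tgt_mem e he

namespace Decomposes

variable {𝒢 : DiMultigraph (Finset V) ε} {𝒩 : Finset (Finset V)} {X S : Finset V} {d : ℝ}
  {Sep : Finset (Finset V)} {P : Finset (Finset (Finset V))}

theorem part_subset (h : 𝒢.Decomposes (singleNodes S) d Sep P) {p : Finset (Finset V)}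
    (hp : p ∈ P) : p ⊆ 𝒢.verts := fun Y hY => (h.cover Y).2 ⟨p, hp, hY⟩

theorem isPartition_flatten (h : 𝒢.Decomposes (singleNodes S) d Sep P) (hX : IsPartition 𝒢.verts X) :
    IsPartition (P.image flatten) X where
  part_nonempty Z hZ := by
    obtain ⟨p, hp, rfl⟩ := Finset.mem_image.1 hZ
    obtain ⟨Y, hY⟩ := h.part_nonempty p hp
    obtain ⟨v, hv⟩ := hX.part_nonempty Y (h.part_subset hp hY)
    exact ⟨v, mem_flatten.2 ⟨Y, hY, hv⟩⟩
  cover v := by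
    rw [hX.cover]
    constructor
    · rintro ⟨Y, hY, hv⟩
      obtain ⟨p, hp, hYp⟩ := (h.cover Y).1 hY
      exact ⟨_, Finset.mem_image_of_mem _ hp, mem_flatten.2 ⟨Y, hYp, hv⟩⟩
    · rintro ⟨Z, hZ, hv⟩
      obtain ⟨p, hp, rfl⟩ := Finset.mem_image.1 hZ
      obtain ⟨Y, hY, hvY⟩ := mem_flatten.1 hv
      exact ⟨Y, h.part_subset hp hY, hvY⟩
  disj Z hZ Z' hZ' v hv hv' := by
    obtain ⟨p, hp, rfl⟩ := Finset.mem_image.1 hZ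
    obtain ⟨q, hq, rfl⟩ := Finset.mem_image.1 hZ'
    obtain ⟨Y, hY, hvY⟩ := mem_flatten.1 hv
    have := hX.mem_of_mem_flatten (h.part_subset hq) (h.part_subset hp hY) hvY hv'
    rw [h.disj p hp q hq Y hY this]

theorem exists_part_superset (h : 𝒢.Decomposes (singleNodes S) d Sep P) {Y : Finset V}
    (hY : Y ∈ 𝒢.verts) : ∃ Z ∈ P.image flatten, Y ⊆ Z := by
  obtain ⟨p, hp, hYp⟩ := (h.cover Y).1 hY
  exact ⟨_, Finset.mem_image_of_mem _ hp, fun v hv => mem_flatten.2 ⟨Y, hYp, hv⟩⟩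

theorem flatten_sep_subset (h : 𝒢.Decomposes (singleNodes S) d Sep P) : flatten Sep ⊆ S :=
  fun _ hv => (singleton_mem_of_mem_flatten h.sep_subset hv).2

theorem singleton_mem_image (h : 𝒢.Decomposes (singleNodes S) d Sep P) {v : V}
    (hv : v ∈ flatten Sep) : {v} ∈ P.image flatten :=
  Finset.mem_image.2 ⟨_, h.sep_single _ (singleton_mem_of_mem_flatten h.sep_subset hv).1,
    flatten_singleton _⟩

theorem sum_image_flatten_le {n : ℕ} (h : 𝒢.Decomposes (singleNodes S) d Sep P) (hd : 0 < d)
    {φ : ℕ → ℕ → ℝ} {c : ℝ} (hφ : IsPotential n d φ c) {W : Finset V} (h𝒩 : IsPartition 𝒩 W)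
    (hW : W.card ≤ n) (hS : ∀ v ∈ S, {v} ∈ 𝒩) (h𝒢 : 𝒢.verts ⊆ 𝒩) (hX : IsPartition 𝒢.verts X) :
    ∑ Z ∈ P.image flatten, φ (Z ∩ S).card Z.card + c * (flatten Sep).card ≤
      φ (X ∩ S).card X.card := by
  have key := h.pays _ _ _ (hφ.paysForCuts hd h𝒩 hW hS) h𝒢
  rw [hX.flatten_eq] at key
  rw [card_flatten_of_subset_singleNodes h.sep_subset, Finset.sum_image]
  · exact key
  · intro p hp q hq hpq
    obtain ⟨Y, hY⟩ := h.part_nonempty p hp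
    obtain ⟨v, hv⟩ := hX.part_nonempty Y (h.part_subset hp hY)
    have : v ∈ flatten q := by
      rw [← show flatten p = flatten q from hpq]
      exact mem_flatten.2 ⟨Y, hY, hv⟩
    exact h.disj p hp q hq Y hY
      (hX.mem_of_mem_flatten (h.part_subset hq) (h.part_subset hp hY) hv this)

/-- Vertices that are mutually reachable without the edges at separators end up in the same part. -/
theorem same_part_flatten (h : 𝒢.Decomposes (singleNodes S) d Sep P) {W : Finset V}
    (h𝒩 : IsPartition 𝒩 W) (h𝒢 : 𝒢.verts ⊆ 𝒩) (hX : IsPartition 𝒢.verts X) {g : DiMultigraph V ε}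
    (hg : ∀ e ∈ g.edges, g.src e ∈ X → g.tgt e ∈ X →
      (e ∈ 𝒢.edges ∧ 𝒢.src e = nodeOf 𝒩 (g.src e) ∧ 𝒢.tgt e = nodeOf 𝒩 (g.tgt e)) ∧
      g.src e ∉ flatten Sep ∧ g.tgt e ∉ flatten Sep)
    {u v : V} (huv : g.Mutual u v) (hX' : ∀ w, g.Mutual u w → w ∈ X) :
    ∃ Z ∈ P.image flatten, u ∈ Z ∧ v ∈ Z := by
  have hXW : X ⊆ W := by
    rw [← hX.flatten_eq, ← h𝒩.flatten_eq]
    exact flatten_mono h𝒢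
  have hnode : ∀ w ∈ X, nodeOf 𝒩 w ∈ 𝒢.verts ∧ w ∈ nodeOf 𝒩 w := by
    intro w hw
    obtain ⟨Y, hY, hwY⟩ := (hX.cover w).1 hw
    rw [h𝒩.nodeOf_eq (h𝒢 hY) hwY]
    exact ⟨hY, hwY⟩
  have key : ∀ a b, g.Mutual u a → g.Mutual a b →
      (𝒢.removeIncident Sep).Reaches (nodeOf 𝒩 a) (nodeOf 𝒩 b) := by
    intro a b hua hab
    refine reflTransGen_map_of_mutual (nodeOf 𝒩) hab.1 hab.2 ?_
    rintro x y ⟨e, he, rfl, rfl⟩ h1 h2 h3 h4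
    have hs := hX' _ ⟨hua.1.trans h1, h2.trans hua.2⟩
    have ht := hX' _ ⟨hua.1.trans h3, h4.trans hua.2⟩
    obtain ⟨⟨k1, k2, k3⟩, k4, k5⟩ := hg e he hs ht
    refine ⟨e, Finset.mem_filter.2 ⟨k1, ?_, ?_⟩, k2, k3⟩
    · rw [k2]
      exact fun k => k4 (mem_flatten.2 ⟨_, k, (hnode _ hs).2⟩)
    · rw [k3]
      exact fun k => k5 (mem_flatten.2 ⟨_, k, (hnode _ ht).2⟩)
  have hu := hnode u (hX' u ⟨.refl, .refl⟩)
  have hv := hnode v (hX' v huv)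
  obtain ⟨p, hp, hup, hvp⟩ := h.same_part _ _ hu.1
    ⟨key u v ⟨.refl, .refl⟩ huv, key v u huv huv.symm⟩
  exact ⟨_, Finset.mem_image_of_mem _ hp, mem_flatten.2 ⟨_, hup, hu.2⟩, mem_flatten.2 ⟨_, hvp, hv.2⟩⟩

end Decomposes

end DiMultigraph

/-! ### The invariant and its preservation under deletions -/

namespace Hierarchy

variable {V ε : Type*} [DecidableEq V] [DecidableEq ε]

/-- What holds in every state of the algorithm; levels below `k` are strongly connected. -/
structure Invariant (G : DiMultigraph V ε) (δ : ℝ) (k : ℕ) (H : Hierarchy V ε) : Prop where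
  verts_eq : H.graph.verts = G.verts
  S_zero : H.S 0 = G.verts
  S_top : ∀ i, Nat.log 2 G.verts.card + 2 ≤ i → H.S i = ∅
  part_zero : H.part 0 = singleNodes G.verts
  partition : ∀ i ≤ Nat.log 2 G.verts.card + 1, IsPartition (H.part i) G.verts
  refines : ∀ i ≤ Nat.log 2 G.verts.card, ∀ Y ∈ H.part i, ∃ X ∈ H.part (i + 1), Y ⊆ X
  single : ∀ i ≤ Nat.log 2 G.verts.card + 1, ∀ v ∈ H.S i, {v} ∈ H.part i
  S_anti : ∀ i, H.S (i + 1) ⊆ H.S i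
  same_part : ∀ i ≤ Nat.log 2 G.verts.card, ∀ u ∈ G.verts, ∀ v,
    (H.graph.removeIncident (H.S (i + 1))).Mutual u v → ∃ X ∈ H.part (i + 1), u ∈ X ∧ v ∈ X
  pays : ∀ i ≤ Nat.log 2 G.verts.card, ∀ φ c, IsPotential G.verts.card (δ / 32) φ c →
    ∑ X ∈ H.part (i + 1), φ (X ∩ H.S i).card X.card + c * (H.S (i + 1)).card ≤
      φ (H.S i).card G.verts.card
  connected : ∀ i < k, i ≤ Nat.log 2 G.verts.card → ∀ X ∈ H.part (i + 1), ∀ Y ∈ H.part i,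
    ∀ Y' ∈ H.part i, Y ⊆ X → Y' ⊆ X → (H.levelGraph i).Reaches Y Y'

theorem isPartition_singleNodes (X : Finset V) : IsPartition (singleNodes X) X where
  part_nonempty p hp := by
    obtain ⟨v, -, rfl⟩ := mem_singleNodes.1 hp
    exact Finset.singleton_nonempty v
  cover v := by
    constructor
    · exact fun hv => ⟨{v}, mem_singleNodes.2 ⟨v, hv, rfl⟩, Finset.mem_singleton_self v⟩
    · rintro ⟨p, hp, hv⟩
      obtain ⟨w, hw, rfl⟩ := mem_singleNodes.1 hp
      rwa [Finset.mem_singleton.1 hv]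
  disj p hp q hq v hvp hvq := by
    obtain ⟨w, -, rfl⟩ := mem_singleNodes.1 hp
    obtain ⟨z, -, rfl⟩ := mem_singleNodes.1 hq
    rw [← Finset.mem_singleton.1 hvp, ← Finset.mem_singleton.1 hvq]

namespace Invariant

variable {G : DiMultigraph V ε} {δ : ℝ} {k : ℕ} {H : Hierarchy V ε}

theorem S_subset_verts (h : Invariant G δ k H) (i : ℕ) : H.S i ⊆ G.verts := by
  induction i with
  | zero => exact h.S_zero.subset
  | succ i ih => exact (h.S_anti i).trans ih

theorem deleteEdge (h : Invariant G δ k H) (e : ε) :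
    Invariant G δ 0 { H with graph := H.graph.deleteEdge e } :=
  { h with
    same_part := by
      intro i hi u hu v huv
      have key : ∀ a b, ((H.graph.deleteEdge e).removeIncident (H.S (i + 1))).Reaches a b →
          (H.graph.removeIncident (H.S (i + 1))).Reaches a b := by
        intro a b hab
        refine hab.of_edges fun f hf => ⟨?_, rfl, rfl⟩
        obtain ⟨h1, h2⟩ := Finset.mem_filter.1 hf
        exact Finset.mem_filter.2 ⟨(Finset.mem_filter.1 h1).1, h2⟩
      exact h.same_part i hi u hu v ⟨key _ _ huv.1, key _ _ huv.2⟩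
    connected := fun i hi => absurd hi (Nat.not_lt_zero i) }

theorem compGraph_verts (H : Hierarchy V ε) (i : ℕ) (X : Finset V) :
    (H.compGraph i X).verts = (H.part i).filter (fun Y => Y ⊆ X) :=
  Finset.inter_eq_right.2 (Finset.filter_subset _ _)

theorem isPartition_compGraph (h : Invariant G δ k H) {i : ℕ} (hi : i ≤ Nat.log 2 G.verts.card)
    {X : Finset V} (hX : X ∈ H.part (i + 1)) : IsPartition (H.compGraph i X).verts X := by
  rw [compGraph_verts]
  have hp := h.partition i (by omega)
  have hp' := h.partition (i + 1) (by omega)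
  refine ⟨fun p hp1 => hp.part_nonempty p (Finset.mem_filter.1 hp1).1, fun v => ⟨fun hv => ?_, ?_⟩,
    fun p hp1 q hq1 => hp.disj p (Finset.mem_filter.1 hp1).1 q (Finset.mem_filter.1 hq1).1⟩
  · obtain ⟨Y, hY, hvY⟩ := (hp.cover v).1 (hp'.subset hX hv)
    obtain ⟨Z, hZ, hYZ⟩ := h.refines i hi Y hY
    have := hp'.disj Z hZ X hX v (hYZ hvY) hv
    exact ⟨Y, Finset.mem_filter.2 ⟨hY, this ▸ hYZ⟩, hvY⟩
  · rintro ⟨Y, hY, hvY⟩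
    exact (Finset.mem_filter.1 hY).2 hvY

theorem next (h : Invariant G δ k H) (hk : k ≤ Nat.log 2 G.verts.card)
    (hfixed : LevelFixed δ k H) : Invariant G δ (k + 1) H :=
  { h with
    connected := by
      intro i hi him X hX Y hY Y' hY' hYX hY'X
      rcases Nat.lt_succ_iff_lt_or_eq.1 hi with hi | rfl
      · exact h.connected i hi him X hX Y hY Y' hY' hYX hY'X
      have hm : ∀ Z ∈ H.part i, Z ⊆ X → Z ∈ (H.compGraph i X).verts := by
        intro Z hZ hZX
        rw [compGraph_verts]
        exact Finset.mem_filter.2 ⟨hZ, hZX⟩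
      have h1 := DiMultigraph.reaches_of_not_far (hfixed X hX Y (hm Y hY hYX)).2
      have h2 := DiMultigraph.reaches_of_not_far (hfixed X hX Y' (hm Y' hY' hY'X)).1
      have h3 : (H.compGraph i X).Reaches Y Y' := h1.trans h2
      exact DiMultigraph.Reaches.of_edges h3 fun e he => ⟨(Finset.mem_filter.1 he).1, rfl, rfl⟩ }

end Invariant

/-- The effect of one iteration at level `i` on the parts and the separators. -/
theorem FixStep.decomposes {G : DiMultigraph V ε} {δ : ℝ} {k i : ℕ} {H H' : Hierarchy V ε}
    (hs : FixStep δ i H H') (hδ : 0 < δ) (h : Invariant G δ k H)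
    (hi : i ≤ Nat.log 2 G.verts.card) :
    ∃ X ∈ H.part (i + 1), ∃ Sep P,
      (H.compGraph i X).Decomposes (singleNodes (H.S i)) (δ / 32) Sep P ∧
      H'.S (i + 1) = H.S (i + 1) ∪ flatten Sep ∧
      H'.part (i + 1) = (H.part (i + 1)).erase X ∪ P.image flatten := by
  obtain ⟨X, hX, Y, hY, T, hT, -, Sep, P, hstep⟩ := hs.step
  have hpart := h.isPartition_compGraph hi hX
  have hSep : (H.compGraph i X).verts ∩ H.compSep i X =
      (H.compGraph i X).verts ∩ singleNodes (H.S i) := by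
    rw [compSep, ← Finset.inter_assoc, Finset.inter_self]
  have hd : δ / 2 / 16 = δ / 32 := by ring
  refine ⟨X, hX, ?_⟩
  rcases hstep with ⟨-, hsplit, hS, hP, -, -⟩ | ⟨-, hsplit, hS, hP, -⟩
  · have hcut : (H.compGraph i X).IsCut (singleNodes (H.S i)) (δ / 32) T :=
      ((hT.isCut (by positivity)).congr hSep).mono (by positivity) (by linarith)
    have h1 := DiMultigraph.SplitRun.decomposes (by positivity) hsplit (singleNodes (H.S i))
      (DiMultigraph.inter_inter_eq_of_verts hSep)
    rw [hd] at h1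
    -- Cutting off `V_Sep` is one cut whose other side is kept whole.
    refine ⟨_, _, hcut.decomposes h1 (DiMultigraph.decomposes_whole _ _ _), ?_, ?_⟩
    · rw [hS, Finset.union_empty]
    · have hTs : T.1 ∪ T.2 ⊆ (H.compGraph i X).verts :=
        Finset.union_subset hcut.sep_subset_verts hcut.side_subset
      have hrest : ((H.compGraph i X).induce ((H.compGraph i X).verts \ (T.1 ∪ T.2))).verts =
          (H.compGraph i X).verts \ (T.1 ∪ T.2) := Finset.inter_eq_right.2 Finset.sdiff_subset
      have hflat := hpart.flatten_sdiff hTs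
      have himage : ((({(H.compGraph i X).verts \ (T.1 ∪ T.2)} :
          Finset (Finset (Finset V))).erase ∅).image flatten) =
          ({X \ flatten (T.1 ∪ T.2)} : Finset (Finset V)).erase ∅ := by
        rw [← hflat]
        rcases Finset.eq_empty_or_nonempty ((H.compGraph i X).verts \ (T.1 ∪ T.2)) with h0 | ⟨Z, hZ⟩
        · rw [h0]
          simp [flatten]
        · have hne : (H.compGraph i X).verts \ (T.1 ∪ T.2) ≠ ∅ := Finset.ne_empty_of_mem hZ
          obtain ⟨v, hv⟩ := hpart.part_nonempty Z (Finset.mem_sdiff.1 hZ).1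
          have hne' : flatten ((H.compGraph i X).verts \ (T.1 ∪ T.2)) ≠ ∅ :=
            Finset.ne_empty_of_mem (mem_flatten.2 ⟨Z, hZ, hv⟩)
          rw [Finset.erase_eq_of_notMem (by simpa using hne.symm),
            Finset.erase_eq_of_notMem (by simpa using hne'.symm), Finset.image_singleton]
      have himage₁ : (T.1.image (fun s => ({s} : Finset (Finset V)))).image flatten = T.1 := by
        rw [Finset.image_image, show flatten ∘ (fun s : Finset V => ({s} : Finset (Finset V))) = id
          from funext flatten_singleton, Finset.image_id]
      rw [hP, hrest, Finset.image_union, Finset.image_union, himage, himage₁, Finset.union_assoc]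
      congr 1
      rw [Finset.union_comm]
  · have h1 := DiMultigraph.SplitRun.decomposes (by positivity) hsplit (singleNodes (H.S i)) hSep
    rw [hd] at h1
    exact ⟨Sep, P, h1, hS, hP⟩

/-- Only `S (k + 1)` and `part (k + 1)` change, and the parts are refined while the separators grow.
The potential inequality is affected twice: at level `k`, where `X` is replaced by its pieces, and
at level `k + 1`, where the set `S (k + 1)` being counted grows. -/
theorem Invariant.fix {G : DiMultigraph V ε} {δ : ℝ} {k : ℕ} {H H' : Hierarchy V ε}
    (h : Invariant G δ k H) (hδ : 0 < δ) (hk : k ≤ Nat.log 2 G.verts.card)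
    (hs : FixStep δ k H H') : Invariant G δ k H' := by
  obtain ⟨X, hX, Sep, P, hdec, hS', hP'⟩ := hs.decomposes hδ h hk
  have hpartX := h.isPartition_compGraph hk hX
  have hR := hdec.isPartition_flatten hpartX
  have hQ := h.partition (k + 1) (by omega)
  have hQ' : IsPartition (H'.part (k + 1)) G.verts := hP' ▸ hQ.replace hX hR
  have hsingle' : ∀ v ∈ H'.S (k + 1), {v} ∈ H'.part (k + 1) := by
    intro v hv
    rw [hS'] at hv
    rw [hP']
    rcases Finset.mem_union.1 hv with hv | hv
    · have h1 := h.single (k + 1) (by omega) v hv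
      -- If an old singleton part is the part being split, its only partition into nonempty sets is
      -- itself, so it is still a part.
      by_cases hvX : {v} = X
      · obtain ⟨Z, hZ, hvZ⟩ := (hR.cover v).1 (hvX ▸ Finset.mem_singleton_self v)
        have h2 : Z ⊆ {v} := hvX ▸ hR.subset hZ
        rw [Finset.mem_union, ← (Finset.Nonempty.subset_singleton_iff ⟨v, hvZ⟩).1 h2]
        exact .inr hZ
      · exact Finset.mem_union_left _ (Finset.mem_erase.2 ⟨hvX, h1⟩)
    · exact Finset.mem_union_right _ (hdec.singleton_mem_image hv)
  have hSle : H.S (k + 1) ⊆ H'.S (k + 1) := hS' ▸ Finset.subset_union_left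
  have hsub' : H'.S (k + 1) ⊆ H.S k := by
    rw [hS']
    exact Finset.union_subset (h.S_anti k) hdec.flatten_sep_subset
  refine ⟨?_, ?_, ?_, ?_, ?_, ?_, ?_, ?_, ?_, ?_, ?_⟩
  · rw [hs.graph_eq, h.verts_eq]
  · rw [hs.S_eq 0 (by omega), h.S_zero]
  · intro i hi
    rw [hs.S_eq i (by omega), h.S_top i hi]
  · rw [hs.part_eq 0 (by omega), h.part_zero]
  · intro i hi
    by_cases hik : i = k + 1
    · exact hik ▸ hQ'
    · exact hs.part_eq i hik ▸ h.partition i hi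
  · intro i hi Y hY
    by_cases hik : i = k
    · subst hik
      rw [hs.part_eq i (by omega)] at hY
      rw [hP']
      obtain ⟨Z, hZ, hYZ⟩ := h.refines i hi Y hY
      by_cases hZX : Z = X
      · obtain ⟨W, hW, hYW⟩ := hdec.exists_part_superset (Y := Y) (by
          rw [Invariant.compGraph_verts]
          exact Finset.mem_filter.2 ⟨hY, hZX ▸ hYZ⟩)
        exact ⟨W, Finset.mem_union_right _ hW, hYW⟩
      · exact ⟨Z, Finset.mem_union_left _ (Finset.mem_erase.2 ⟨hZX, hZ⟩), hYZ⟩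
    · rw [hs.part_eq (i + 1) (by omega)]
      by_cases hik' : i = k + 1
      · subst hik'
        rw [hP'] at hY
        rcases Finset.mem_union.1 hY with hY | hY
        · exact h.refines _ hi Y (Finset.mem_of_mem_erase hY)
        · obtain ⟨Z, hZ, hXZ⟩ := h.refines _ hi X hX
          exact ⟨Z, hZ, (hR.subset hY).trans hXZ⟩
      · rw [hs.part_eq i hik'] at hY
        exact h.refines i hi Y hY
  · intro i hi
    by_cases hik : i = k + 1
    · exact hik ▸ hsingle'
    · rw [hs.part_eq i hik, hs.S_eq i hik]
      exact h.single i hi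
  · intro i
    by_cases hik : i = k
    · subst hik
      rw [hs.S_eq i (by omega)]
      exact hsub'
    · rw [hs.S_eq (i + 1) (by omega)]
      by_cases hik' : i = k + 1
      · subst hik'
        exact (h.S_anti _).trans hSle
      · rw [hs.S_eq i hik']
        exact h.S_anti i
  · intro i hi u hu v huv
    rw [hs.graph_eq] at huv
    by_cases hik : i = k
    · subst hik
      -- More separators leave fewer edges, so the class of `u` lies in one old part; if that part
      -- is `X`, the decomposition of `X` takes over.
      have hold : ∀ w, (H.graph.removeIncident (H'.S (i + 1))).Mutual u w →
          ∃ X ∈ H.part (i + 1), u ∈ X ∧ w ∈ X := fun w hw =>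
        h.same_part i hi u hu w (hw.mono_removeIncident hSle)
      obtain ⟨Z, hZ, huZ, hvZ⟩ := hold v huv
      rw [hP']
      by_cases hZX : Z = X
      · subst hZX
        obtain ⟨W, hW, huW, hvW⟩ := hdec.same_part_flatten (h.partition i (by omega))
          (by rw [Invariant.compGraph_verts]; exact Finset.filter_subset _ _) hpartX
          (g := H.graph.removeIncident (H'.S (i + 1))) (by
            intro e he hsrc htgt
            obtain ⟨k1, k2, k3⟩ := Finset.mem_filter.1 he
            have hnode : ∀ w ∈ Z, DiMultigraph.nodeOf (H.part i) w ∈ H.part i ∧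
                DiMultigraph.nodeOf (H.part i) w ∈ (H.part i).filter (fun Y => Y ⊆ Z) := by
              intro w hw
              obtain ⟨Y, hY, hwY⟩ := (hpartX.cover w).1 hw
              rw [Invariant.compGraph_verts] at hY
              rw [(h.partition i (by omega)).nodeOf_eq (Finset.mem_filter.1 hY).1 hwY]
              exact ⟨(Finset.mem_filter.1 hY).1, hY⟩
            refine ⟨⟨?_, rfl, rfl⟩, ?_, ?_⟩
            · refine Finset.mem_filter.2 ⟨Finset.mem_filter.2 ⟨Finset.mem_filter.2
                ⟨k1, fun k => k2 (hSle k), fun k => k3 (hSle k)⟩, ?_, ?_⟩, ?_, ?_⟩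
              · exact (hnode _ hsrc).1
              · exact (hnode _ htgt).1
              · exact (hnode _ hsrc).2
              · exact (hnode _ htgt).2
            · exact fun k => k2 (hS' ▸ Finset.mem_union_right _ k)
            · exact fun k => k3 (hS' ▸ Finset.mem_union_right _ k)) huv (by
            intro w hw
            obtain ⟨Z', hZ', huZ', hwZ'⟩ := hold w hw
            rwa [hQ.disj Z hZ Z' hZ' u huZ huZ'])
        exact ⟨W, Finset.mem_union_right _ hW, huW, hvW⟩
      · exact ⟨Z, Finset.mem_union_left _ (Finset.mem_erase.2 ⟨hZX, hZ⟩), huZ, hvZ⟩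
    · rw [hs.S_eq (i + 1) (by omega)] at huv
      rw [hs.part_eq (i + 1) (by omega)]
      exact h.same_part i hi u hu v huv
  · intro i hi φ c hφ
    by_cases hik : i = k
    · subst hik
      have h0 := h.pays i hi φ c hφ
      have h1 := hdec.sum_image_flatten_le (by positivity) hφ (h.partition i (by omega)) le_rfl
        (h.single i (by omega))
        (by rw [Invariant.compGraph_verts]; exact Finset.filter_subset _ _) hpartX
      have h2 := DiMultigraph.sum_union_le_add (f := fun Z : Finset V => φ (Z ∩ H.S i).card Z.card)
        (fun _ => hφ.nonneg _ _) ((H.part (i + 1)).erase X) (P.image flatten)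
      have h3 : ((H'.S (i + 1)).card : ℝ) ≤ (H.S (i + 1)).card + (flatten Sep).card := by
        rw [hS']
        exact_mod_cast Finset.card_union_le _ _
      have h4 := mul_le_mul_of_nonneg_left h3 hφ.cost_nonneg
      rw [← Finset.add_sum_erase _ _ hX] at h0
      rw [hs.S_eq i (by omega), hP']
      linarith
    · rw [hs.S_eq (i + 1) (by omega), hs.part_eq (i + 1) (by omega)]
      have h0 := h.pays i hi φ c hφ
      by_cases hik' : i = k + 1
      · subst hik'
        -- At level `k + 1` the parts and `S (k + 2)` are unchanged, and the larger `S (k + 1)` is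
        -- accounted for by `sum_grow`.
        have hsubV : H.S (k + 1) ∪ flatten Sep ⊆ G.verts := hS' ▸ hsub'.trans (h.S_subset_verts k)
        have := (h.partition (k + 1 + 1) (by omega)).sum_grow hφ (H.S (k + 1)) (flatten Sep) hsubV
        rw [hS']
        linarith
      · rwa [hs.S_eq i hik']
  · intro i hi him
    -- For `i < k` the level graph involves only `part i` and `S (i + 1)`, whose indices are at most
    -- `k`.
    have e1 : H'.levelGraph i = H.levelGraph i := by
      rw [levelGraph, levelGraph, hs.graph_eq, hs.S_eq (i + 1) (by omega), hs.part_eq i (by omega)]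
    rw [e1, hs.part_eq (i + 1) (by omega), hs.part_eq i (by omega)]
    exact h.connected i hi him

end Hierarchy

/-! ### The state after preprocessing, and all reachable states -/

namespace Hierarchy

variable {V ε : Type*} [DecidableEq V] [DecidableEq ε]

theorem IsPreprocessed.level_decomposes {G : DiMultigraph V ε} {δ : ℝ} {H : Hierarchy V ε}
    (h : IsPreprocessed G δ H) (hδ : 0 < δ) {i : ℕ} (hi : i ≤ Nat.log 2 G.verts.card) :
    ∃ Sep P, (G.contract (H.part i)).Decomposes (singleNodes (H.S i)) (δ / 32) Sep P ∧
      (∀ p ∈ P, ∀ Y ∈ p, ∀ Y' ∈ p, ((G.contract (H.part i)).induce p).Reaches Y Y') ∧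
      H.S (i + 1) = flatten Sep ∧ H.part (i + 1) = P.image flatten := by
  obtain ⟨Sep, P, hsplit, hS, hP, -⟩ := h.level i hi
  have h1 := DiMultigraph.SplitRun.decomposes (by positivity) hsplit (singleNodes (H.S i)) rfl
  rw [show δ / 2 / 16 = δ / 32 by ring] at h1
  exact ⟨Sep, P, h1, DiMultigraph.SplitRun.reaches hsplit, hS, hP⟩

theorem IsPreprocessed.partition {G : DiMultigraph V ε} {δ : ℝ} {H : Hierarchy V ε}
    (h : IsPreprocessed G δ H) (hδ : 0 < δ) {i : ℕ} (hi : i ≤ Nat.log 2 G.verts.card + 1) :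
    IsPartition (H.part i) G.verts ∧ ∀ v ∈ H.S i, {v} ∈ H.part i := by
  induction i with
  | zero =>
    rw [h.part_zero, h.S_zero]
    exact ⟨isPartition_singleNodes _, fun v hv => mem_singleNodes.2 ⟨v, hv, rfl⟩⟩
  | succ i ih =>
    obtain ⟨Sep, P, hdec, -, hS, hP⟩ := h.level_decomposes hδ (Nat.le_of_succ_le_succ hi)
    have hpart : IsPartition (G.contract (H.part i)).verts G.verts := (ih (by omega)).1
    rw [hS, hP]
    exact ⟨hdec.isPartition_flatten hpart, fun v hv => hdec.singleton_mem_image hv⟩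

theorem IsPreprocessed.invariant {G : DiMultigraph V ε} {δ : ℝ} {H : Hierarchy V ε}
    (h : IsPreprocessed G δ H) (hδ : 0 < δ) (k : ℕ) : Invariant G δ k H where
  verts_eq := by rw [h.graph_eq]
  S_zero := h.S_zero
  S_top := h.S_top
  part_zero := h.part_zero
  partition i hi := (h.partition hδ hi).1
  single i hi := (h.partition hδ hi).2
  refines i hi Y hY := by
    obtain ⟨Sep, P, hdec, -, hS, hP⟩ := h.level_decomposes hδ hi
    rw [hP]
    exact hdec.exists_part_superset hY
  S_anti i := by
    rcases Nat.lt_or_ge (Nat.log 2 G.verts.card) i with hi | hi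
    · rw [h.S_top (i + 1) (by omega)]
      exact Finset.empty_subset _
    · obtain ⟨Sep, P, hdec, -, hS, hP⟩ := h.level_decomposes hδ hi
      rw [hS]
      exact hdec.flatten_sep_subset
  same_part i hi u hu v huv := by
    obtain ⟨Sep, P, hdec, -, hS, hP⟩ := h.level_decomposes hδ hi
    have hpart := (h.partition hδ (i := i) (by omega)).1
    rw [hP]
    rw [h.graph_eq] at huv
    refine hdec.same_part_flatten hpart (Finset.Subset.refl _) hpart ?_ huv
      fun w hw => hw.1.mem_verts hu
    intro e he hs ht
    obtain ⟨k1, k2, k3⟩ := Finset.mem_filter.1 he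
    refine ⟨⟨?_, rfl, rfl⟩, hS ▸ k2, hS ▸ k3⟩
    exact Finset.mem_filter.2 ⟨k1, (hpart.nodeOf_mem hs).1, (hpart.nodeOf_mem ht).1⟩
  pays i hi φ c hφ := by
    obtain ⟨Sep, P, hdec, -, hS, hP⟩ := h.level_decomposes hδ hi
    obtain ⟨hpart, hsingle⟩ := h.partition hδ (i := i) (by omega)
    have := hdec.sum_image_flatten_le (by positivity) hφ hpart le_rfl hsingle
      (Finset.Subset.refl _) hpart
    rw [hP, hS]
    refine this.trans (le_of_eq ?_)
    rw [Finset.inter_eq_right.2]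
    intro v hv
    exact hpart.subset (hsingle v hv) (Finset.mem_singleton_self v)
  connected i _ hi X hX Y hY Y' hY' hYX hY'X := by
    obtain ⟨Sep, P, hdec, hreach, hS, hP⟩ := h.level_decomposes hδ hi
    obtain ⟨hpart, -⟩ := h.partition hδ (i := i) (by omega)
    obtain ⟨hpart', hsingle'⟩ := h.partition hδ (i := i + 1) (by omega)
    have hX' := hX
    rw [hP] at hX'
    obtain ⟨p, hp, rfl⟩ := Finset.mem_image.1 hX'
    have hpsub : p ⊆ H.part i := hdec.part_subset hp
    have hmem : ∀ Z ∈ H.part i, Z ⊆ flatten p → Z ∈ p := by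
      intro Z hZ hZp
      obtain ⟨v, hv⟩ := hpart.part_nonempty Z hZ
      exact hpart.mem_of_mem_flatten hpsub hZ hv (hZp hv)
    -- `Split` saw all edges, while the level graph lacks those at the new separators. A part
    -- containing a separator is a singleton, hence a single node; a part without one keeps all its
    -- inner edges.
    by_cases hsep : ∃ v ∈ H.S (i + 1), v ∈ flatten p
    · obtain ⟨v, hv, hvp⟩ := hsep
      have hXv := hpart'.disj _ hX _ (hsingle' v hv) v hvp (Finset.mem_singleton_self v)
      rw [hXv] at hYX hY'X
      rw [(Finset.Nonempty.subset_singleton_iff (hpart.part_nonempty Y hY)).1 hYX,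
        (Finset.Nonempty.subset_singleton_iff (hpart.part_nonempty Y' hY')).1 hY'X]
      exact .refl
    · have hno : ∀ w ∈ flatten p, w ∉ H.S (i + 1) := fun w hw hwS => hsep ⟨w, hwS, hw⟩
      refine DiMultigraph.Reaches.of_edges
        (hreach p hp Y (hmem Y hY hYX) Y' (hmem Y' hY' hY'X)) fun e he => ⟨?_, ?_, ?_⟩
      · obtain ⟨k1, k2, k3⟩ := Finset.mem_filter.1 he
        obtain ⟨k4, k5⟩ := Finset.mem_filter.1 k1
        rw [levelGraph, h.graph_eq]
        refine Finset.mem_filter.2 ⟨Finset.mem_filter.2 ⟨k4, hno _ ?_, hno _ ?_⟩, k5⟩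
        · exact mem_flatten.2 ⟨_, k2, (hpart.nodeOf_mem (G.src_mem e k4)).2⟩
        · exact mem_flatten.2 ⟨_, k3, (hpart.nodeOf_mem (G.tgt_mem e k4)).2⟩
      · rw [levelGraph, h.graph_eq]
        rfl
      · rw [levelGraph, h.graph_eq]
        rfl

theorem Course.invariant {G : DiMultigraph V ε} {δ : ℝ} (hδ : 0 < δ) {k : ℕ} {H : Hierarchy V ε}
    (h : Course G δ k H) : Invariant G δ k H := by
  induction h with
  | start h => exact h.invariant hδ _
  | delete _ he ih => exact ih.deleteEdge _
  | fix _ hk hstep ih => exact ih.fix hδ hk hstep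
  | next _ hk hfixed ih => exact ih.next hk hfixed

/-! ### The bounds and the condensation -/

namespace Invariant

variable {G : DiMultigraph V ε} {δ : ℝ} {k : ℕ} {H : Hierarchy V ε}

/-- With `m = |S_i|`, `t = |S_{i+1}|` and `x` running over the part counts, the potential `x lg x`
bounds `(δ / (32 log n) + 2) t` by `m lg m - ∑ x lg x`. This is at most `2 + ∑ x (lg (n - 1) - lg
x)`, as `∑ x = m ≤ n`, and the last sum is at most `∑ x lg (n - x)`. -/
theorem card_succ_le_sum (h : Invariant G δ k H) (hδ : 0 < δ) {i : ℕ}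
    (hi : i ≤ Nat.log 2 G.verts.card) :
    ((H.S (i + 1)).card : ℝ) ≤ 32 * Real.log (G.verts.card : ℝ) / δ *
      ∑ X ∈ H.part (i + 1),
        Real.logb 2 ((G.verts.card : ℝ) - ((X ∩ H.S i).card : ℝ)) * ((X ∩ H.S i).card : ℝ) := by
  set n := G.verts.card with hn
  set m := (H.S i).card with hm
  set t := (H.S (i + 1)).card with ht
  have hpay := h.pays i hi _ _ (isPotential_mul_logb (n := n) (d := δ / 32) (by positivity))
  have hmn : m ≤ n := Finset.card_le_card (h.S_subset_verts i)
  have hpart := h.partition (i + 1) (Nat.succ_le_succ hi)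
  have hxm : ∀ X : Finset V, (X ∩ H.S i).card ≤ m := fun X =>
    Finset.card_le_card Finset.inter_subset_right
  have hsum : (m : ℝ) = ∑ X ∈ H.part (i + 1), ((X ∩ H.S i).card : ℝ) := by
    exact_mod_cast (hpart.sum_card_inter (h.S_subset_verts i)).symm
  have hlog0 := Real.log_natCast_nonneg n
  have hle : ∀ X ∈ H.part (i + 1),
      ((X ∩ H.S i).card : ℝ) * (Real.logb 2 ((n : ℝ) - 1) - Real.logb 2 (X ∩ H.S i).card) ≤
      Real.logb 2 ((n : ℝ) - ((X ∩ H.S i).card : ℝ)) * ((X ∩ H.S i).card : ℝ) := fun X _ =>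
    mul_logb_div_le ((hxm X).trans hmn)
  have hsumle := Finset.sum_le_sum hle
  have hsumeq : ∑ X ∈ H.part (i + 1), ((X ∩ H.S i).card : ℝ) *
      (Real.logb 2 ((n : ℝ) - 1) - Real.logb 2 (X ∩ H.S i).card) =
      m * Real.logb 2 ((n : ℝ) - 1) -
        ∑ X ∈ H.part (i + 1), ((X ∩ H.S i).card : ℝ) * Real.logb 2 (X ∩ H.S i).card := by
    rw [hsum, Finset.sum_mul, ← Finset.sum_sub_distrib]
    exact Finset.sum_congr rfl fun X _ => by ring
  set F := ∑ X ∈ H.part (i + 1),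
    Real.logb 2 ((n : ℝ) - ((X ∩ H.S i).card : ℝ)) * ((X ∩ H.S i).card : ℝ) with hF
  have hFnonneg : 0 ≤ F := by
    refine Finset.sum_nonneg fun X _ => mul_nonneg ?_ (Nat.cast_nonneg _)
    have : ((n : ℝ) - ((X ∩ H.S i).card : ℝ)) = ((n - (X ∩ H.S i).card : ℕ) : ℝ) :=
      (Nat.cast_sub ((hxm X).trans hmn)).symm
    rw [this, Real.logb]
    exact div_nonneg (Real.log_natCast_nonneg _) (Real.log_nonneg (by norm_num))
  rcases Nat.eq_zero_or_pos t with ht0 | ht0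
  · rw [ht0, Nat.cast_zero]
    positivity
  have htm : t ≤ m := Finset.card_le_card (h.S_anti i)
  have ht1 : (1 : ℝ) ≤ t := by exact_mod_cast ht0
  have hm1 : (1 : ℝ) ≤ m := by exact_mod_cast ht0.trans_le htm
  have hmn' : (m : ℝ) ≤ n := by exact_mod_cast hmn
  have hxlogx : 0 ≤ ∑ X ∈ H.part (i + 1), ((X ∩ H.S i).card : ℝ) *
      Real.logb 2 (X ∩ H.S i).card := Finset.sum_nonneg fun X _ => by
    refine mul_nonneg (Nat.cast_nonneg _) ?_
    rw [Real.logb]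
    exact div_nonneg (Real.log_natCast_nonneg _) (Real.log_nonneg (by norm_num))
  -- For `n ≤ 1` and `t ≥ 1` one has `m = 1`, so the potential starts at 0 and cannot pay a rate of
  -- at least 2.
  have hn2 : 2 ≤ n := by
    by_contra hlt
    have : m = 1 := by
      have : 1 ≤ m := ht0.trans_le htm
      omega
    rw [← hm, ← ht, this] at hpay
    simp only [Nat.cast_one, Real.logb_one, mul_zero] at hpay
    have : 0 ≤ δ / 32 / Real.log n := by positivity
    nlinarith
  have hn2' : (2 : ℝ) ≤ n := by exact_mod_cast hn2
  have hlog : 0 < Real.log n := Real.log_pos (by linarith)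
  have hmlog : (m : ℝ) * Real.logb 2 m ≤ m * Real.logb 2 ((n : ℝ) - 1) + 2 := by
    have h1 : Real.logb 2 m ≤ Real.logb 2 n :=
      Real.logb_le_logb_of_le (by norm_num) (by linarith) hmn'
    have h2 := mul_logb_sub_le hn2
    have h3 : 0 ≤ Real.logb 2 n - Real.logb 2 ((n : ℝ) - 1) :=
      sub_nonneg.2 (Real.logb_le_logb_of_le (by norm_num) (by linarith) (by linarith))
    have h4 := mul_le_mul_of_nonneg_right hmn' h3
    have h5 := mul_le_mul_of_nonneg_left h1 (by linarith : (0 : ℝ) ≤ m)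
    linarith
  -- The summand 2 of the rate contributes `2t ≥ 2`, which cancels the error 2 in `hmlog`.
  have hK : δ / 32 / Real.log n * t ≤ F := by linarith
  rw [div_div, div_mul_eq_mul_div, div_le_iff₀ (by positivity)] at hK
  rw [div_mul_eq_mul_div, le_div_iff₀ hδ]
  linarith

theorem card_succ_le (h : Invariant G δ k H) (hδ : 0 < δ) (i : ℕ) :
    ((H.S (i + 1)).card : ℝ) ≤
      16 * Real.logb 2 (G.verts.card : ℝ) ^ 2 / δ * ((H.S i).card : ℝ) := by
  rcases Nat.lt_or_ge (Nat.log 2 G.verts.card) i with hi | hi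
  · rw [h.S_top (i + 1) (by omega), Finset.card_empty, Nat.cast_zero]
    positivity
  · have hpay := h.pays i hi _ _ (isPotential_mul_logb_sq (n := G.verts.card) hδ)
    have : 0 ≤ ∑ X ∈ H.part (i + 1),
        16 / δ * (((X ∩ H.S i).card : ℝ) * Real.logb 2 (X.card : ℝ) ^ 2) :=
      Finset.sum_nonneg fun X _ => by positivity
    have e : 16 * Real.logb 2 (G.verts.card : ℝ) ^ 2 / δ * ((H.S i).card : ℝ) =
        16 / δ * (((H.S i).card : ℝ) * Real.logb 2 (G.verts.card : ℝ) ^ 2) := by ring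
    rw [e]
    linarith

theorem card_le_div_two_pow (h : Invariant G δ k H) (hδ : 0 < δ)
    (hδ' : δ = 64 * Real.logb 2 (G.verts.card : ℝ) ^ 2) (i : ℕ) :
    ((H.S i).card : ℝ) ≤ (G.verts.card : ℝ) / 2 ^ i := by
  induction i with
  | zero => rw [h.S_zero]; simp
  | succ i ih =>
    have h1 := h.card_succ_le hδ i
    -- The factor is even smaller than the 1/2 that is needed.
    have e : 16 * Real.logb 2 (G.verts.card : ℝ) ^ 2 / δ = 1 / 4 := by
      rw [div_eq_iff hδ.ne', hδ']
      ring
    rw [e] at h1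
    have h2 : (0 : ℝ) ≤ (H.S i).card := Nat.cast_nonneg _
    rw [pow_succ, ← div_div]
    linarith

/-- Induction over the levels: a walk in the level graph between two nodes of a part is lifted by
joining consecutive edges inside the nodes, which are strongly connected without the edges at `S i`,
hence also without only those at `S (i + 1) ⊆ S i`. -/
theorem reaches_of_mem_part (h : Invariant G δ (Nat.log 2 G.verts.card + 1) H) {i : ℕ}
    (hi : i ≤ Nat.log 2 G.verts.card + 1) {X : Finset V} (hX : X ∈ H.part i) {u v : V}
    (hu : u ∈ X) (hv : v ∈ X) : (H.graph.removeIncident (H.S i)).Reaches u v := by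
  induction i generalizing X u v with
  | zero =>
    rw [h.part_zero] at hX
    obtain ⟨w, -, rfl⟩ := mem_singleNodes.1 hX
    rw [Finset.mem_singleton.1 hu, Finset.mem_singleton.1 hv]
    exact .refl
  | succ i ih =>
    have hpart := h.partition i (by omega)
    have hpart' := h.partition (i + 1) hi
    have hin : ∀ w ∈ X, ∃ Y ∈ H.part i, Y ⊆ X ∧ w ∈ Y := by
      intro w hw
      obtain ⟨Y, hY, hwY⟩ := (hpart.cover w).1 (hpart'.subset hX hw)
      obtain ⟨Z, hZ, hYZ⟩ := h.refines i (by omega) Y hY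
      exact ⟨Y, hY, hpart'.disj Z hZ X hX w (hYZ hwY) hw ▸ hYZ, hwY⟩
    obtain ⟨Y, hY, hYX, huY⟩ := hin u hu
    obtain ⟨Y', hY', hYX', hvY'⟩ := hin v hv
    have hreach := h.connected i (by omega) (by omega) X hX Y hY Y' hY' hYX hYX'
    have hnode : ∀ Z ∈ H.part i, ∀ a ∈ Z, ∀ b ∈ Z,
        (H.graph.removeIncident (H.S (i + 1))).Reaches a b := fun Z hZ a ha b hb =>
      (ih (by omega) hZ ha hb).mono_removeIncident (h.S_anti i)
    have step : ∀ Z, (H.levelGraph i).Reaches Y Z → ∀ w ∈ Z,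
        (H.graph.removeIncident (H.S (i + 1))).Reaches u w := by
      intro Z hYZ
      induction hYZ with
      | refl => exact hnode Y hY u huY
      | tail _ hbc ihb =>
        obtain ⟨e, he, rfl, rfl⟩ := hbc
        obtain ⟨k1, -, k3⟩ := Finset.mem_filter.1 he
        have ks := h.verts_eq ▸ H.graph.src_mem e (Finset.mem_filter.1 k1).1
        have kt := h.verts_eq ▸ H.graph.tgt_mem e (Finset.mem_filter.1 k1).1
        intro w hw
        exact ((ihb _ (hpart.nodeOf_mem ks).2).tail ⟨e, k1, rfl, rfl⟩).trans
          (hnode _ k3 _ (hpart.nodeOf_mem kt).2 w hw)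
    exact step Y' hreach v hvY'

/-- With no separators left, `reaches_of_mem_part` puts each part inside one SCC and the invariant
`same_part` puts each SCC inside one part. -/
theorem part_eq_sccs (h : Invariant G δ (Nat.log 2 G.verts.card + 1) H)
    (hS : H.S (Nat.log 2 G.verts.card + 1) = ∅) :
    H.part (Nat.log 2 G.verts.card + 1) = H.graph.sccs := by
  have hpart := h.partition _ le_rfl
  have key : ∀ X ∈ H.part (Nat.log 2 G.verts.card + 1), ∀ v ∈ X,
      ∀ u, u ∈ X ↔ u ∈ H.graph.verts ∧ H.graph.Reaches u v ∧ H.graph.Reaches v u := by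
    intro X hX v hv u
    constructor
    · intro hu
      have h1 := h.reaches_of_mem_part le_rfl hX hu hv
      have h2 := h.reaches_of_mem_part le_rfl hX hv hu
      rw [hS, DiMultigraph.removeIncident_empty] at h1 h2
      exact ⟨h.verts_eq ▸ hpart.subset hX hu, h1, h2⟩
    · rintro ⟨-, huv, hvu⟩
      obtain ⟨Z, hZ, hvZ, huZ⟩ := h.same_part _ le_rfl v (hpart.subset hX hv) u (by
        rw [hS, DiMultigraph.removeIncident_empty]
        exact ⟨hvu, huv⟩)
      rwa [hpart.disj X hX Z hZ v hv hvZ]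
  ext X
  simp only [DiMultigraph.sccs, Finset.mem_image]
  constructor
  · intro hX
    obtain ⟨v, hv⟩ := hpart.part_nonempty X hX
    refine ⟨v, h.verts_eq ▸ hpart.subset hX hv, ?_⟩
    ext u
    simp only [Finset.mem_filter, key X hX v hv u]
  · rintro ⟨v, hv, rfl⟩
    obtain ⟨X, hX, hvX⟩ := (hpart.cover v).1 (h.verts_eq ▸ hv)
    convert hX
    ext u
    simp only [Finset.mem_filter, key X hX v hvX u]

theorem levelGraph_top_eq (h : Invariant G δ (Nat.log 2 G.verts.card + 1) H) (hδ : 0 < δ)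
    (hδ' : δ = 64 * Real.logb 2 (G.verts.card : ℝ) ^ 2) :
    H.levelGraph (Nat.log 2 G.verts.card + 1) = H.graph.condensation := by
  have hS : H.S (Nat.log 2 G.verts.card + 1) = ∅ := by
    have h1 := h.card_le_div_two_pow hδ hδ' (Nat.log 2 G.verts.card + 1)
    have h2 : (G.verts.card : ℝ) < 2 ^ (Nat.log 2 G.verts.card + 1) := by
      exact_mod_cast Nat.lt_pow_succ_log_self (by norm_num) _
    have h3 : ((H.S (Nat.log 2 G.verts.card + 1)).card : ℝ) < 1 :=
      h1.trans_lt ((div_lt_one (by positivity)).2 h2)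
    exact Finset.card_eq_zero.1 (Nat.lt_one_iff.1 (by exact_mod_cast h3))
  rw [levelGraph, h.S_top _ le_rfl, DiMultigraph.removeIncident_empty, h.part_eq_sccs hS]
  rfl

end Invariant

end Hierarchy

theorem mainTheorem8 {V ε : Type*} [DecidableEq V] [DecidableEq ε]
    (G : DiMultigraph V ε) (δ : ℝ) (hδ : 0 < δ) (k : ℕ) (H : Hierarchy V ε)
    (hH : Hierarchy.Course G δ k H) :
    (H.S 0).card = G.verts.card ∧
    (∀ i ≤ Nat.log 2 G.verts.card,
      ((H.S (i + 1)).card : ℝ) ≤ 32 * Real.log (G.verts.card : ℝ) / δ *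
        ∑ X ∈ H.part (i + 1),
          Real.logb 2 ((G.verts.card : ℝ) - ((X ∩ H.S i).card : ℝ)) * ((X ∩ H.S i).card : ℝ)) ∧
    (∀ i : ℕ, ((H.S (i + 1)).card : ℝ) ≤
      16 * Real.logb 2 (G.verts.card : ℝ) ^ 2 / δ * ((H.S i).card : ℝ)) ∧
    (δ = 64 * Real.logb 2 (G.verts.card : ℝ) ^ 2 →
      (∀ i : ℕ, ((H.S i).card : ℝ) ≤ (G.verts.card : ℝ) / 2 ^ i) ∧
      (k = Nat.log 2 G.verts.card + 1 →
        H.levelGraph (Nat.log 2 G.verts.card + 1) = H.graph.condensation)) := by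
  have h := hH.invariant hδ
  refine ⟨by rw [h.S_zero], fun i hi => h.card_succ_le_sum hδ hi, h.card_succ_le hδ,
    fun hδ' => ⟨h.card_le_div_two_pow hδ hδ', ?_⟩⟩
  rintro rfl
  exact h.levelGraph_top_eq hδ hδ'
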